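/- Fix a finite alphabet $\Sigma$ with a distinguished symbol $\bot\in\Sigma$. Consider non-empty lists $s=w_1:\dots:w_n$ of non-empty words over $\Sigma\times\{1,2\}\times\mathbb N$, and write $w_n=a_1\cdots a_m$, $a_m=(\sigma,i,j)$. Put $\mathrm{TOP}_2(s)=w_n$, $\mathrm{Sym}(s)=\sigma$, $\mathrm{Lvl}(s)=i$, $|s|=n$. The stack operations are $\mathrm{pop}_2(s)=w_1:\dots:w_{n-1}$ (defined if $n\ge2$); $\mathrm{pop}_1(s)=w_1:\dots:w_{n-1}:a_1\cdots a_{m-1}$ (defined if $m\ge2$); $\mathrm{clone}_2(s)=w_1:\dots:w_n:w_n$; for $\tau\in\Sigma\setminus\{\bot\}$, $\mathrm{push}_{\tau,1}(s)$ and $\mathrm{push}_{\tau,2}(s)$ append $(\tau,1,m)$ and $(\tau,2,n-1)$, respectively, to $w_n$; $\mathrm{collapse}(s)$ is $w_1:\dots:w_j$ if $i=2$ and $j>0$, is $\mathrm{pop}_1(s)$ if $i=1$, and is undefined otherwise. The set of stacks is the smallest set that contains the one-letter stack $(\bot,1,0)$ and is closed under these (partial) operations. Write $s'\le s$ if $s'=\mathrm{pop}_1^{n_1}(\mathrm{pop}_2^{n_2}(s))$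 for some $n_1,n_2\in\mathbb N$, and $s'<s$ if moreover $s'\ne s$. A level-2 collapsible pushdown system is $S=(\Sigma,Q,\Delta,q_0)$ with $Q$ finite, $q_0\in Q$ and $\Delta\subseteq Q\times\Sigma\times Q\times\mathrm{Op}$, where $\mathrm{Op}$ is the set of the operations above. For $q,q'\in Q$ and stacks $s,t$ there is a transition $(q,s)\to(q',t)$ if there is $(q,\mathrm{Sym}(s),q',op)\in\Delta$ with $op(s)=t$. A run of length $n\ge 0$ is a sequence $r(0)\to r(1)\to\dots\to r(n)$, where $r(i)=(q_i,s_i)$. A run of length $n$ is a simple high loop if $s_0=s_n$ and $s_0<s_i$ for all $0<i<n$. Simple low loops are defined inductively: a run of length $n\geq 2$ is a simple low loop of $s$ if $s_0=s_n=s$, $s_i\neq s$ for $0<i<n$, $\mathrm{Lvl}(s)=1$, $s_1=\mathrm{pop}_1(s)$, $|s_i|\ge|s|$ for all $0\le i\le n$, and the restriction of the run to $\{1,\dots,n-1\}$ is a finite composition of simple low loops and simple high loops of $\mathrm{pop}_1(s)$. A loop is a finite composition of simple low loops and simple high loops. For a stack $s$ let $\mathrm{Loops}(s)\subseteq Q\times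 Q$ be the set of pairs $(q_1,q_2)$ such that there is a loop from $(q_1,s)$ to $(q_2,s)$. Let $\pi:(\Sigma\times\{1,2\}\times\mathbb N)^*\to(\Sigma\times\{1,2\})^*$ be the projection to symbols and collapse levels. **Lemma.** For every level-2 collapsible pushdown system $S=(\Sigma,Q,\Delta,q_0)$ there is a deterministic finite automaton $A$ over the alphabet $\Sigma\times\{1,2\}$, together with a map that assigns to each state of $A$ a subset of $Q\times Q$, such that for every word $w\in(\Sigma\times\{1,2\})^*$ and every stack $s$ with $w=\pi(\mathrm{TOP}_2(s))$, the set assigned to the state which $A$ reaches on input $w$ is $\mathrm{Loops}(s)$. -/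

import Mathlib

namespace Cpds

/-- The two possible collapse levels `1` and `2`. -/
inductive Level where
  | one
  | two

/-- An element `(σ, i, j)` of a stack: symbol `σ`, collapse level `i`, collapse link `j`. -/
abbrev Elem (Γ : Type*) := Γ × Level × ℕ

/-- Lists `w₁ : w₂ : … : wₙ` of words over `Γ × {1,2} × ℕ`. The top of the stack is at the
right end: the topmost word is `wₙ`, and the topmost element is the last letter of `wₙ`. -/
abbrev TwoWord (Γ : Type*) := List (List (Elem Γ))

section Stacks

variable {Γ : Type*}

/-- The topmost word of a 2-word (the empty word for the empty 2-word, which is not a stack). -/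
def topWord (s : TwoWord Γ) : List (Elem Γ) := s.getLastD []

/-- The topmost element of a 2-word. -/
def topElem? (s : TwoWord Γ) : Option (Elem Γ) := (topWord s).getLast?

/-- The topmost symbol. -/
def sym? (s : TwoWord Γ) : Option Γ := (topElem? s).map (fun a => a.1)

/-- The collapse level of the topmost element. -/
def lvl? (s : TwoWord Γ) : Option Level := (topElem? s).map (fun a => a.2.1)

/-- Remove the topmost element; defined if the topmost word has at least two letters. -/
def pop1 (s : TwoWord Γ) : Option (TwoWord Γ) :=
  if 2 ≤ (topWord s).length then some (s.dropLast ++ [(topWord s).dropLast]) else none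

/-- Remove the topmost word; defined if there are at least two words. -/
def pop2 (s : TwoWord Γ) : Option (TwoWord Γ) :=
  if 2 ≤ s.length then some s.dropLast else none

/-- Duplicate the topmost word. -/
def clone2 (s : TwoWord Γ) : TwoWord Γ := s ++ [topWord s]

/-- `push σ k` appends `(σ, 1, m)` if `k = 1` and `(σ, 2, n - 1)` if `k = 2` to the topmost word,
where `m` is the length of the topmost word and `n` the number of words. -/
def push (σ : Γ) : Level → TwoWord Γ → TwoWord Γ
  | .one, s => s.dropLast ++ [topWord s ++ [(σ, .one, (topWord s).length)]]
  | .two, s => s.dropLast ++ [topWord s ++ [(σ, .two, s.length - 1)]]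

/-- Follow the collapse pointer of the topmost element. -/
def collapse (s : TwoWord Γ) : Option (TwoWord Γ) :=
  match topElem? s with
  | some (_, .two, r) => if 0 < r then some (s.take r) else none
  | some (_, .one, _) => pop1 s
  | none => none

/-- The stack operations of level `2`; the bottom symbol cannot be pushed. -/
inductive Op {Γ : Type*} (bot : Γ) where
  | push (σ : Γ) (hσ : σ ≠ bot) (k : Level)
  | clone2
  | pop1
  | pop2
  | collapse

/-- The partial function on 2-words that an operation denotes. -/
def Op.apply {bot : Γ} : Op bot → TwoWord Γ → Option (TwoWord Γ)
  | .push σ _ k, s => some (Cpds.push σ k s)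
  | .clone2, s => some (Cpds.clone2 s)
  | .pop1, s => Cpds.pop1 s
  | .pop2, s => Cpds.pop2 s
  | .collapse, s => Cpds.collapse s

/-- The level `2` stacks: the smallest set that contains the initial stack, whose only letter is
`(⊥, 1, 0)`, and is closed under all operations. -/
inductive IsStack (bot : Γ) : TwoWord Γ → Prop
  | init : IsStack bot [[(bot, .one, 0)]]
  | step {s t : TwoWord Γ} (op : Op bot) (hs : IsStack bot s) (ht : op.apply s = some t) :
      IsStack bot t

/-- `t` is a substack of `s`: `t = pop₁^{n₁} (pop₂^{n₂} s)` for some `n₁, n₂`. -/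
def Substack (t s : TwoWord Γ) : Prop :=
  ∃ n₁ n₂ : ℕ, (fun o => Option.bind o pop1)^[n₁] ((fun o => Option.bind o pop2)^[n₂] (some s)) =
    some t

/-- `t` is a proper substack of `s`. -/
def ProperSubstack (t s : TwoWord Γ) : Prop := Substack t s ∧ t ≠ s

/-- The projection of words to the symbols and collapse levels. -/
def proj (w : List (Elem Γ)) : List (Γ × Level) := w.map (fun a => (a.1, a.2.1))

end Stacks

/-- Collapsible pushdown systems of level `2` with stack alphabet `Γ` and state set `Q`
(both are assumed to be finite where the notion is used). -/
structure System (Γ Q : Type*) where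
  bot : Γ
  init : Q
  delta : Set (Q × Γ × Q × Op bot)

namespace System

variable {Γ Q : Type*} (S : System Γ Q)

/-- The one-step transition relation on configurations `(q, s)`. -/
def Trans (c d : Q × TwoWord Γ) : Prop :=
  IsStack S.bot c.2 ∧
    ∃ (σ : Γ) (op : Op S.bot), (c.1, σ, d.1, op) ∈ S.delta ∧ sym? c.2 = some σ ∧
      op.apply c.2 = some d.2

/-- The restriction of `r` to `{a, a + 1, …, b}` is a run (of length `b - a`). Values of `r` outside
of this interval are irrelevant, here and in all the following notions. -/
def IsRun (r : ℕ → Q × TwoWord Γ) (a b : ℕ) : Prop :=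
  a ≤ b ∧ ∀ i, a ≤ i → i < b → S.Trans (r i) (r (i + 1))

/-- The restriction of `r` to `{a, …, b}` is a simple high loop: it starts and ends in the same
stack, which is a proper substack of every stack visited in between. -/
def IsSimpleHighLoop (r : ℕ → Q × TwoWord Γ) (a b : ℕ) : Prop :=
  S.IsRun r a b ∧ (r a).2 = (r b).2 ∧
    ∀ i, a < i → i < b → ProperSubstack (r a).2 (r i).2

mutual

/-- The restriction of `r` to `{a, …, b}` is a simple low loop. -/
inductive IsSimpleLowLoop (r : ℕ → Q × TwoWord Γ) : ℕ → ℕ → Prop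
  | mk {a b : ℕ} (run : S.IsRun r a b) (ends : (r a).2 = (r b).2)
      (notVisited : ∀ i, a < i → i < b → (r i).2 ≠ (r a).2)
      (first : pop1 (r a).2 = some (r (a + 1)).2)
      (level : lvl? (r a).2 = some Level.one)
      (width : ∀ i, a ≤ i → i ≤ b → (r a).2.length ≤ (r i).2.length)
      (inner : IsLoop r (a + 1) (b - 1)) : IsSimpleLowLoop r a b

/-- The restriction of `r` to `{a, …, b}` is a loop: a finite composition of simple low loops and
simple high loops. (All of them start and end in one and the same stack, and a run of length `0`
is a simple high loop.) -/
inductive IsLoop (r : ℕ → Q × TwoWord Γ) : ℕ → ℕ → Prop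
  | high {a b : ℕ} (h : S.IsSimpleHighLoop r a b) : IsLoop r a b
  | low {a b : ℕ} (h : IsSimpleLowLoop r a b) : IsLoop r a b
  | comp {a b c : ℕ} (h : IsLoop r a b) (h' : IsLoop r b c) : IsLoop r a c

end

/-- The pairs `(q₁, q₂)` such that there is a loop from `(q₁, s)` to `(q₂, s)`. -/
def loops (s : TwoWord Γ) : Set (Q × Q) :=
  {p | ∃ (r : ℕ → Q × TwoWord Γ) (n : ℕ),
    S.IsLoop r 0 n ∧ r 0 = (p.1, s) ∧ r n = (p.2, s)}

end System

end Cpds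

/-!
Whether a loop of a stack `u : w` exists depends only on the symbols and levels in `w`, and what
has to be known about `w` is finite and can be updated letter by letter. Both facts come from
describing runs by inductively defined relations on states and words, without stacks and links.

* `Ret` describes the runs that start in a stack `u : x` and end in a fixed narrower stack `t`, at
  the first moment when the width of `t` is reached. All that matters about a collapse link in `x` is
  whether it leads to `t`. So the letters carry a `Mark`. After a clone the run either comes back to
  the cloned stack, or it ends with a collapse through a copy of a letter whose link leads to `t`.
* `LoopTo` describes the loops of `u : w`, where the part of the word that has been pushed on `w` is
  a second argument. A clone has to be undone, which is the case `t = u : wy` of `Ret`. As a cloned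
  word has no link to the stack that was cloned, only `deadWord` occurs here, and it is a function of
  symbols and levels. The case of simple low loops removes the last letter of `w`, performs
  a loop of the shorter word and pushes the letter again.

`mem_loops_iff` says that `LoopTo` is correct. A run is turned into derivations by induction on its
length (`ret_of_run`, `loopTo_of_run`, `loopTo_of_isLoop`), a derivation into a run by induction on
the derivation (`Ret.runWhile`, `LoopTo.exists_runWhile_hasLoop`). A simple low loop of `s` must not
visit `s` in between, so `LoopTo` has a parameter that forbids one letter to be pushed on `u : w`.

The type of `w` (`wordType`) consists of its last symbol and of the values of both relations at `w`.
If `v` and `w` have the same type, then so do `vz` and `wz`, since derivations over `vz` can be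
copied to `wz`: as soon as `z` is used up, the remaining derivation is part of the type
(`Ret.congr`, `LoopTo.congr`). There are finitely many types, so they are the states of
a deterministic automaton (`exists_dfa_of_congr`).
-/

namespace Cpds

variable {Γ Q : Type*}

/-! ### Stacks and single transitions -/

@[simp] theorem topWord_append (u : TwoWord Γ) (w) : topWord (u ++ [w]) = w := by
  simp [topWord, List.getLastD_eq_getLast?]

theorem sym?_append (u : TwoWord Γ) (w) (a) : sym? (u ++ [w ++ [a]]) = some a.1 := by
  simp [sym?, topElem?]

theorem lvl?_append (u : TwoWord Γ) (w) (a) : lvl? (u ++ [w ++ [a]]) = some a.2.1 := by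
  simp [lvl?, topElem?]

theorem pop1_append (u : TwoWord Γ) (w) (a) :
    pop1 (u ++ [w ++ [a]]) = if w ≠ [] then some (u ++ [w]) else none := by
  have h : 2 ≤ (w ++ [a]).length ↔ w ≠ [] := by
    cases w <;> simp
  unfold pop1
  simp only [topWord_append, h, List.dropLast_concat]

/-- The link that `push` attaches to a new letter of level `k` on the stack `u : w`. -/
def newLink (u : TwoWord Γ) (w : List (Elem Γ)) : Level → ℕ
  | .one => w.length
  | .two => u.length

theorem push_append (u : TwoWord Γ) (w) (τ : Γ) (k) :
    push τ k (u ++ [w]) = u ++ [w ++ [(τ, k, newLink u w k)]] := by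
  cases k <;> simp [push, newLink]

/-- The links of a word standing at position `N` (counted from `0`) in a stack: a letter of level
`1` carries its own position in the word, and a link of level `2` is at most `N`. -/
def GoodWord (N : ℕ) (w : List (Elem Γ)) : Prop :=
  w ≠ [] ∧ ∀ (p : ℕ) (a : Elem Γ), w[p]? = some a → (a.2.1 = .one → a.2.2 = p) ∧ (a.2.1 = .two → a.2.2 ≤ N)

/-- The part of being a stack on which the analysis of runs relies. -/
def WellFormed (s : TwoWord Γ) : Prop :=
  s ≠ [] ∧ ∀ (k : ℕ) w, s[k]? = some w → GoodWord k w

theorem wellFormed_append {u : TwoWord Γ} {w} :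
    WellFormed (u ++ [w]) ↔ (∀ (k : ℕ) w, u[k]? = some w → GoodWord k w) ∧ GoodWord u.length w := by
  constructor
  · rintro ⟨-, h⟩
    refine ⟨fun k v hk => h k v ?_, h _ _ (by simp)⟩
    rw [List.getElem?_append_left]
    · exact hk
    · exact (List.getElem?_eq_some_iff.1 hk).1
  · rintro ⟨h, h'⟩
    refine ⟨by simp, fun k v hk => ?_⟩
    rcases lt_trichotomy k u.length with hl | rfl | hl
    · rw [List.getElem?_append_left hl] at hk
      exact h _ _ hk
    · simp at hk
      exact hk ▸ h'
    · rw [List.getElem?_eq_none (by simp; omega)] at hk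
      cases hk

theorem goodWord_append {N : ℕ} {w : List (Elem Γ)} {a : Elem Γ} :
    GoodWord N (w ++ [a]) ↔ (w ≠ [] → GoodWord N w) ∧
      (a.2.1 = .one → a.2.2 = w.length) ∧ (a.2.1 = .two → a.2.2 ≤ N) := by
  constructor
  · rintro ⟨-, h⟩
    refine ⟨fun hw => ⟨hw, fun p b hp => h p b ?_⟩, h _ _ (by simp)⟩
    rw [List.getElem?_append_left]
    · exact hp
    · exact (List.getElem?_eq_some_iff.1 hp).1
  · rintro ⟨h, h'⟩
    refine ⟨by simp, fun k v hk => ?_⟩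
    rcases lt_trichotomy k w.length with hl | rfl | hl
    · rw [List.getElem?_append_left hl] at hk
      exact (h (by rintro rfl; simp at hl)).2 _ _ hk
    · simp at hk
      exact hk ▸ h'
    · rw [List.getElem?_eq_none (by simp; omega)] at hk
      cases hk

theorem GoodWord.mono {N M : ℕ} (h : N ≤ M) {w : List (Elem Γ)} (hw : GoodWord N w) :
    GoodWord M w :=
  ⟨hw.1, fun p a hp => ⟨(hw.2 p a hp).1, fun h2 => ((hw.2 p a hp).2 h2).trans h⟩⟩

theorem WellFormed.exists_eq {s : TwoWord Γ} (h : WellFormed s) :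
    ∃ u w a, s = u ++ [w ++ [a]] := by
  obtain ⟨u, x, rfl⟩ := (List.eq_nil_or_concat' s).resolve_left h.1
  obtain ⟨w, a, rfl⟩ := (List.eq_nil_or_concat' x).resolve_left (wellFormed_append.1 h).2.1
  exact ⟨u, w, a, rfl⟩

theorem WellFormed.take {s : TwoWord Γ} (h : WellFormed s) {n : ℕ} (hn : 0 < n) :
    WellFormed (s.take n) := by
  refine ⟨by simp [h.1]; omega, fun k w hk => h.2 k w ?_⟩
  rw [List.getElem?_take] at hk
  split_ifs at hk
  exact hk

/-- `PopStep S q σ p q'`: the transition relation permits to remove a topmost letter `σ`, where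
`p` says that the letter has level `1`, so that `collapse` removes it as well. -/
def PopStep (S : System Γ Q) (q : Q) (σ : Γ) (p : Prop) (q' : Q) : Prop :=
  (q, σ, q', .pop1) ∈ S.delta ∨ p ∧ (q, σ, q', .collapse) ∈ S.delta

/-- The possible effects of one transition from state `q` to `q'` on the stack `u : wa`. -/
inductive Move (S : System Γ Q) (u : TwoWord Γ) (w : List (Elem Γ)) (a : Elem Γ) (q q' : Q) :
    TwoWord Γ → Prop
  | push (τ : Γ) (hτ : τ ≠ S.bot) (k : Level) (h : (q, a.1, q', .push τ hτ k) ∈ S.delta) :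
      Move S u w a q q' (u ++ [w ++ [a] ++ [(τ, k, newLink u (w ++ [a]) k)]])
  | clone (h : (q, a.1, q', .clone2) ∈ S.delta) :
      Move S u w a q q' (u ++ [w ++ [a]] ++ [w ++ [a]])
  | pop (h : PopStep S q a.1 (a.2.1 = .one) q') (hw : w ≠ []) : Move S u w a q q' (u ++ [w])
  | pop2 (h : (q, a.1, q', .pop2) ∈ S.delta) (hu : u ≠ []) : Move S u w a q q' u
  | collapse (h : (q, a.1, q', .collapse) ∈ S.delta) (h2 : a.2.1 = .two) (h0 : 0 < a.2.2) :
      Move S u w a q q' ((u ++ [w ++ [a]]).take a.2.2)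

theorem two_le_length_append {u : TwoWord Γ} {x} : 2 ≤ (u ++ [x]).length ↔ u ≠ [] := by
  cases u <;> simp

theorem collapse_one (u : TwoWord Γ) (w : List (Elem Γ)) (σ : Γ) (j : ℕ) :
    collapse (u ++ [w ++ [(σ, .one, j)]]) = pop1 (u ++ [w ++ [(σ, .one, j)]]) := by
  simp [collapse, topElem?]

theorem collapse_two (u : TwoWord Γ) (w : List (Elem Γ)) (σ : Γ) (j : ℕ) :
    collapse (u ++ [w ++ [(σ, .two, j)]]) =
      if 0 < j then some ((u ++ [w ++ [(σ, Level.two, j)]]).take j) else none := by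
  simp [collapse, topElem?]

theorem trans_iff {S : System Γ Q} {u : TwoWord Γ} {w a q q' t} :
    S.Trans (q, u ++ [w ++ [a]]) (q', t) ↔
      IsStack S.bot (u ++ [w ++ [a]]) ∧ Move S u w a q q' t := by
  unfold System.Trans
  refine and_congr_right fun hs => ?_
  simp only [sym?_append]
  constructor
  · rintro ⟨_, op, hd, ⟨⟩, ht⟩
    cases op with
    | push τ hτ k =>
      simp only [Op.apply, push_append, Option.some.injEq] at ht
      exact ht ▸ .push τ hτ k hd
    | clone2 =>
      simp only [Op.apply, clone2, topWord_append, Option.some.injEq] at ht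
      exact ht ▸ .clone hd
    | pop1 =>
      simp only [Op.apply, pop1_append] at ht
      split_ifs at ht with h
      cases ht
      exact .pop (.inl hd) h
    | pop2 =>
      simp only [Op.apply, pop2, two_le_length_append, List.dropLast_concat] at ht
      split_ifs at ht with h
      cases ht
      exact .pop2 hd h
    | collapse =>
      obtain ⟨σ, k, j⟩ := a
      cases k with
      | one =>
        simp only [Op.apply, collapse_one, pop1_append] at ht
        split_ifs at ht with h
        cases ht
        exact .pop (.inr ⟨rfl, hd⟩) h
      | two =>
        simp only [Op.apply, collapse_two] at ht
        split_ifs at ht with h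
        cases ht
        exact .collapse hd rfl h
  · intro h
    cases h with
    | push τ hτ k h => exact ⟨_, _, h, rfl, by simp only [Op.apply, push_append]⟩
    | clone h => exact ⟨_, _, h, rfl, by simp only [Op.apply, clone2, topWord_append]⟩
    | pop h hw =>
      rcases h with h | ⟨h1, h⟩
      · exact ⟨_, _, h, rfl, by simp only [Op.apply, pop1_append, if_pos hw]⟩
      · obtain ⟨σ, k, j⟩ := a
        cases h1
        exact ⟨_, _, h, rfl, by simp only [Op.apply, collapse_one, pop1_append, if_pos hw]⟩
    | pop2 h hu =>
      refine ⟨_, _, h, rfl, ?_⟩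
      simp only [Op.apply, pop2, two_le_length_append, List.dropLast_concat, if_pos hu]
    | collapse h h2 h0 =>
      obtain ⟨σ, k, j⟩ := a
      cases h2
      exact ⟨_, _, h, rfl, by simp only [Op.apply, collapse_two, if_pos h0]⟩

theorem System.Trans.isStack {S : System Γ Q} {c d} (h : S.Trans c d) : IsStack S.bot d.2 := by
  obtain ⟨hs, σ, op, -, -, ht⟩ := h
  exact .step op hs ht

theorem WellFormed.move {S : System Γ Q} {u : TwoWord Γ} {w a q q' t}
    (hs : WellFormed (u ++ [w ++ [a]])) (h : Move S u w a q q' t) : WellFormed t := by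
  have h1 := wellFormed_append.1 hs
  cases h with
  | push τ hτ k h =>
    refine wellFormed_append.2 ⟨h1.1, goodWord_append.2 ⟨fun _ => h1.2, ?_⟩⟩
    constructor <;> rintro ⟨⟩ <;> simp [newLink]
  | clone h => exact wellFormed_append.2 ⟨hs.2, h1.2.mono (by simp)⟩
  | pop h hw => exact wellFormed_append.2 ⟨h1.1, (goodWord_append.1 h1.2).1 hw⟩
  | pop2 h hu => exact ⟨hu, h1.1⟩
  | collapse h h2 h0 => exact hs.take h0

theorem IsStack.wellFormed {bot : Γ} {s : TwoWord Γ} (h : IsStack bot s) : WellFormed s := by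
  induction h with
  | init =>
    refine wellFormed_append (u := []).2 ⟨by simp, ?_⟩
    exact goodWord_append (w := []).2 ⟨by simp, by simp, by simp⟩
  | @step s t op hs ht ih =>
    obtain ⟨u, w, a, rfl⟩ := ih.exists_eq
    -- Every operation is a transition of the system in which all transitions are allowed.
    let S : System Γ Unit := ⟨bot, (), Set.univ⟩
    have : S.Trans ((), u ++ [w ++ [a]]) ((), t) :=
      ⟨hs, a.1, op, trivial, sym?_append _ _ _, ht⟩
    exact ih.move (trans_iff.1 this).2

/-- A transition that keeps the width at least `k` changes none of the words below the topmost one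
among the lowest `k` words. -/
theorem take_eq_of_trans {S : System Γ Q} {c d : Q × TwoWord Γ} (h : S.Trans c d) {k : ℕ}
    (hc : k < c.2.length) (hd : k ≤ d.2.length) : d.2.take k = c.2.take k := by
  obtain ⟨u, w, a, hs⟩ := h.1.wellFormed.exists_eq
  obtain ⟨q, s⟩ := c
  obtain ⟨q', t⟩ := d
  subst hs
  simp only [List.length_append, List.length_cons, List.length_nil] at hc
  cases (trans_iff.1 h).2 <;>
    simp_all [List.take_append_of_le_length, List.take_take]

/-- The structural form of `Substack`: `t = u : w` and `s = u : wy : r` with `w` non-empty. The two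
notions agree on stacks by `Substack.below` and `Below.substack`. -/
def Below (t s : TwoWord Γ) : Prop :=
  ∃ u w y r, t = u ++ [w] ∧ s = u ++ [w ++ y] ++ r ∧ w ≠ []

theorem pop2_eq_some {s t : TwoWord Γ} : pop2 s = some t ↔ t ≠ [] ∧ ∃ x, s = t ++ [x] := by
  rcases List.eq_nil_or_concat' s with rfl | ⟨u, x, rfl⟩
  · simp [pop2]
  · simp only [pop2, two_le_length_append, List.dropLast_concat]
    split_ifs with h
    · simp only [Option.some.injEq]
      constructor
      · rintro rfl
        exact ⟨h, x, rfl⟩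
      · rintro ⟨-, y, hy⟩
        exact (List.append_inj' hy rfl).1
    · simp only [false_iff, not_and, not_exists]
      intro ht y hy
      exact h ((List.append_inj' hy rfl).1 ▸ ht)

theorem pop1_eq_some {u : TwoWord Γ} {x t} :
    pop1 (u ++ [x]) = some t ↔ ∃ w a, w ≠ [] ∧ x = w ++ [a] ∧ t = u ++ [w] := by
  rcases List.eq_nil_or_concat' x with rfl | ⟨w, a, rfl⟩
  · simp [pop1]
  · rw [pop1_append]
    split_ifs with h
    · simp only [Option.some.injEq]
      constructor
      · rintro rfl
        exact ⟨w, a, h, rfl, rfl⟩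
      · rintro ⟨v, b, -, hv, rfl⟩
        rw [(List.append_inj' hv rfl).1]
    · simp only [false_iff, not_exists]
      rintro v b ⟨hv, hy, -⟩
      exact h ((List.append_inj' hy rfl).1 ▸ hv)

theorem Substack.below {s t : TwoWord Γ} (hs : WellFormed s) (h : Substack t s) : Below t s := by
  obtain ⟨n₁, n₂, h⟩ := h
  have h2 : ∀ n t, (fun o => Option.bind o pop2)^[n] (some s) = some t →
      t ≠ [] ∧ ∃ r, s = t ++ r := by
    intro n
    induction n with
    | zero =>
      rintro t ⟨⟩
      exact ⟨hs.1, [], by simp⟩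
    | succ n ih =>
      intro t ht
      rw [Function.iterate_succ_apply', Option.bind_eq_some_iff] at ht
      obtain ⟨t', h', ht⟩ := ht
      obtain ⟨ht0, x, rfl⟩ := pop2_eq_some.1 ht
      obtain ⟨-, r, hr⟩ := ih _ h'
      exact ⟨ht0, [x] ++ r, by simp [hr]⟩
  cases h3 : (fun o => Option.bind o pop2)^[n₂] (some s) with
  | none =>
    rw [h3] at h
    have : ∀ n, (fun o => Option.bind o (pop1 (Γ := Γ)))^[n] none = none := by
      intro n
      induction n with
      | zero => rfl
      | succ n ih => rw [Function.iterate_succ_apply', ih]; rfl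
    rw [this] at h
    cases h
  | some s' =>
    rw [h3] at h
    obtain ⟨h0, r, rfl⟩ := h2 _ _ h3
    obtain ⟨u, x, rfl⟩ := (List.eq_nil_or_concat' s').resolve_left h0
    have hx : x ≠ [] := (hs.2 u.length x (by simp)).1
    have h1 : ∀ n t, (fun o => Option.bind o pop1)^[n] (some (u ++ [x])) = some t →
        ∃ w y, t = u ++ [w] ∧ x = w ++ y ∧ w ≠ [] := by
      intro n
      induction n with
      | zero =>
        rintro t ⟨⟩
        exact ⟨x, [], rfl, by simp, hx⟩
      | succ n ih =>
        intro t ht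
        rw [Function.iterate_succ_apply', Option.bind_eq_some_iff] at ht
        obtain ⟨t', h', ht⟩ := ht
        obtain ⟨w, y, rfl, rfl, -⟩ := ih _ h'
        obtain ⟨v, a, hv, rfl, rfl⟩ := pop1_eq_some.1 ht
        exact ⟨v, [a] ++ y, rfl, by simp, hv⟩
    obtain ⟨w, y, rfl, rfl, hw⟩ := h1 _ _ h
    exact ⟨u, w, y, r, rfl, rfl, hw⟩

theorem Below.substack {s t : TwoWord Γ} (h : Below t s) : Substack t s := by
  obtain ⟨u, w, y, r, rfl, rfl, hw⟩ := h
  refine ⟨y.length, r.length, ?_⟩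
  have h2 : ∀ (x : List (Elem Γ)) (r : TwoWord Γ),
      (fun o => Option.bind o pop2)^[r.length] (some (u ++ [x] ++ r)) = some (u ++ [x]) := by
    intro x r
    induction r using List.reverseRecOn with
    | nil => simp
    | append_singleton r z ih =>
      rw [List.length_append, List.length_singleton, Function.iterate_succ_apply]
      convert ih using 2
      exact pop2_eq_some.2 ⟨by simp, z, by simp⟩
  rw [h2]
  clear h2
  induction y using List.reverseRecOn with
  | nil => simp
  | append_singleton y a ih =>
    rw [List.length_append, List.length_singleton, Function.iterate_succ_apply]
    convert ih using 2
    exact pop1_eq_some.2 ⟨w ++ y, a, by simp [hw], by simp, rfl⟩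

theorem Below.length_le {s t : TwoWord Γ} (h : Below t s) : t.length ≤ s.length := by
  obtain ⟨u, w, y, r, rfl, rfl, hw⟩ := h
  simp

theorem WellFormed.below_self {s : TwoWord Γ} (h : WellFormed s) : Below s s := by
  obtain ⟨u, w, a, rfl⟩ := h.exists_eq
  exact ⟨u, w ++ [a], [], [], rfl, by simp, by simp⟩

/-- Words on top of `s` do not matter for the substacks that are not wider than `s`. -/
theorem Below.of_append {t s r : TwoWord Γ} (h : Below t (s ++ r)) (hl : t.length ≤ s.length) :
    Below t s := by
  obtain ⟨u, w, y, r', rfl, h, hw⟩ := h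
  have h' : s <+: u ++ [w ++ y] ++ r' := ⟨r, h⟩
  have h2 : u ++ [w ++ y] <+: s :=
    List.prefix_of_prefix_length_le ⟨r', rfl⟩ h' (by simpa using hl)
  obtain ⟨r2, rfl⟩ := h2
  exact ⟨u, w, y, r2, rfl, rfl, hw⟩

theorem below_append_singleton {t u : TwoWord Γ} {x} (hl : t.length = u.length + 1) :
    Below t (u ++ [x]) ↔ ∃ w y, t = u ++ [w] ∧ x = w ++ y ∧ w ≠ [] := by
  constructor
  · rintro ⟨u', w, y, r, rfl, h, hw⟩
    have hr : r = [] := by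
      have := congrArg List.length h
      simp at this hl
      exact List.length_eq_zero_iff.1 (by omega)
    subst hr
    rw [List.append_nil] at h
    obtain ⟨rfl, h⟩ := List.append_inj' h rfl
    exact ⟨w, y, rfl, by simpa using h, hw⟩
  · rintro ⟨w, y, rfl, rfl, hw⟩
    exact ⟨u, w, y, [], rfl, by simp, hw⟩

/-! ### Abstract runs on words and their congruence -/

/-- What matters about the collapse link of a letter for runs towards a fixed stack `t`: the letter
has level `1`, or it has level `2` and its link does not lead to `t` (`dead`) or leads to `t`
(`live`). -/
inductive Mark where
  | one
  | dead
  | live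

/-- The mark of a letter of the given level whose link, if it has level `2`, is not the target. -/
def Level.deadMark : Level → Mark
  | .one => .one
  | .two => .dead

/-- The mark of a letter of the given level whose link, if it has level `2`, is the target. -/
def Level.liveMark : Level → Mark
  | .one => .one
  | .two => .live

/-- Turn live letters into dead ones: after `clone2` the next target is the cloned stack, to which
no link in its topmost word leads. -/
def Mark.kill : Mark → Mark
  | .one => .one
  | _ => .dead

/-- The symbol of the last letter. -/
def topSym {β : Type*} (x : List (Γ × β)) : Option Γ := x.getLast?.map Prod.fst

/-- The word `w` with all letters of level `2` dead. -/
def deadWord (w : List (Γ × Level)) : List (Γ × Mark) := w.map fun a => (a.1, a.2.deadMark)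

/-- `Mark.kill` on all letters of a word. -/
def killWord (x : List (Γ × Mark)) : List (Γ × Mark) := x.map fun a => (a.1, a.2.kill)

@[simp] theorem topSym_append_singleton {β : Type*} (x : List (Γ × β)) (a) :
    topSym (x ++ [a]) = some a.1 := by
  simp [topSym]

/-- `Ret S f x q q'`: from state `q` and a stack whose topmost word has the marks `x` with respect
to a narrower stack `t`, there is a run to `(q', t)` that reaches the width of `t` only at its end,
and before the end does not become narrower than its first stack. The flag `f` says that the first
stack is wider than `t` by exactly one word. Only then `t` can be reached by `pop2`, and only then
the link of a new letter of level `2` leads to `t`.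

A clone is either undone (`cloneRet`), and the run up to there has the cloned stack as its target,
or it is never undone (`cloneExit`), and then the run ends by a collapse. -/
inductive Ret (S : System Γ Q) : Bool → List (Γ × Mark) → Q → Q → Prop
  | pop2 {x σ q q'} (hx : topSym x = some σ) (h : (q, σ, q', .pop2) ∈ S.delta) : Ret S true x q q'
  | collapse {f x σ q q'} (h : (q, σ, q', .collapse) ∈ S.delta) : Ret S f (x ++ [(σ, .live)]) q q'
  | pop {f x σ m q q₁ q'} (h : PopStep S q σ (m = .one) q₁) (hx : x ≠ []) (h' : Ret S f x q₁ q') :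
      Ret S f (x ++ [(σ, m)]) q q'
  | push {f x σ τ hτ k q q₁ q'} (hx : topSym x = some σ) (h : (q, σ, q₁, .push τ hτ k) ∈ S.delta)
      (h' : Ret S f (x ++ [(τ, bif f then k.liveMark else k.deadMark)]) q₁ q') : Ret S f x q q'
  | cloneRet {f x σ q q₁ q₂ q'} (hx : topSym x = some σ) (h : (q, σ, q₁, .clone2) ∈ S.delta)
      (h₁ : Ret S true (killWord x) q₁ q₂) (h₂ : Ret S f x q₂ q') : Ret S f x q q'
  | cloneExit {f x σ q q₁ q'} (hx : topSym x = some σ) (h : (q, σ, q₁, .clone2) ∈ S.delta)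
      (h' : Ret S false x q₁ q') : Ret S f x q q'

/-- `LoopTo S F w y q q'`: from state `q` and a stack `u : wy` there is a run to `(q', u : w)` that
stays above `u : w` until this stack is visited, and is a loop from there on. If `F = some τ`, then
the run does not push `τ` with level `1` on `u : w`; such runs are the ones that occur inside simple
low loops of `u : w(τ,1)`. -/
inductive LoopTo (S : System Γ Q) :
    Option Γ → List (Γ × Level) → List (Γ × Level) → Q → Q → Prop
  | refl {F w q} : LoopTo S F w [] q q
  | pop {F w y σ k q q₁ q'} (h : PopStep S q σ (k = .one) q₁) (h' : LoopTo S F w y q₁ q') :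
      LoopTo S F w (y ++ [(σ, k)]) q q'
  | push {F w y σ τ hτ k q q₁ q'} (hy : topSym (w ++ y) = some σ)
      (h : (q, σ, q₁, .push τ hτ k) ∈ S.delta) (hF : y = [] → k = .one → F ≠ some τ)
      (h' : LoopTo S F w (y ++ [(τ, k)]) q₁ q') : LoopTo S F w y q q'
  | clone {F w y σ q q₁ q₂ q'} (hy : topSym (w ++ y) = some σ) (h : (q, σ, q₁, .clone2) ∈ S.delta)
      (h₁ : Ret S true (deadWord (w ++ y)) q₁ q₂) (h₂ : LoopTo S F w y q₂ q') : LoopTo S F w y q q'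
  | low {F w σ τ hσ q q₁ q₂ q₃ q'} (h : PopStep S q σ True q₁) (h₁ : LoopTo S (some σ) w [] q₁ q₂)
      (hw : topSym w = some τ) (h₂ : (q₂, τ, q₃, .push σ hσ .one) ∈ S.delta)
      (h₃ : LoopTo S F (w ++ [(σ, .one)]) [] q₃ q') : LoopTo S F (w ++ [(σ, .one)]) [] q q'

theorem LoopTo.trans {S : System Γ Q} {F w y q q₁ q'} (h : LoopTo S F w y q q₁)
    (h' : LoopTo S F w [] q₁ q') : LoopTo S F w y q q' := by
  induction h with
  | refl => exact h'
  | pop h _ ih => exact .pop h (ih h')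
  | push hy h hF _ ih => exact .push hy h hF (ih h')
  | clone hy h h₁ _ ih => exact .clone hy h h₁ (ih h')
  | low h h₁ hw h₂ _ _ ih => exact .low h h₁ hw h₂ (ih h')

/-- The finite information about a word `w` that determines the loops of stacks with the topmost
word `w`, and that is compatible with appending letters. -/
def wordType (S : System Γ Q) (w : List (Γ × Level)) :
    Option Γ × Set (Bool × Q × Q) × Set (Option Γ × Q × Q) :=
  (topSym w, {p | Ret S p.1 (deadWord w) p.2.1 p.2.2}, {p | LoopTo S p.1 w [] p.2.1 p.2.2})

theorem wordType_eq_iff {S : System Γ Q} {v w : List (Γ × Level)} :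
    wordType S v = wordType S w ↔ topSym v = topSym w ∧
      (∀ f q q', Ret S f (deadWord v) q q' ↔ Ret S f (deadWord w) q q') ∧
      (∀ F q q', LoopTo S F v [] q q' ↔ LoopTo S F w [] q q') := by
  simp [wordType, Set.ext_iff]

theorem topSym_eq_none {β : Type*} {x : List (Γ × β)} : topSym x = none ↔ x = [] := by
  simp [topSym]

theorem topSym_append_congr {β : Type*} {x y : List (Γ × β)} (h : topSym x = topSym y) (z) :
    topSym (x ++ z) = topSym (y ++ z) := by
  rcases List.eq_nil_or_concat' z with rfl | ⟨z, a, rfl⟩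
  · simpa using h
  · simp only [← List.append_assoc, topSym_append_singleton]

theorem topSym_deadWord (w : List (Γ × Level)) : topSym (deadWord w) = topSym w := by
  rcases List.eq_nil_or_concat' w with rfl | ⟨z, a, rfl⟩ <;> simp [deadWord, topSym]

theorem killWord_deadWord_append (w : List (Γ × Level)) (z : List (Γ × Mark)) :
    killWord (deadWord w ++ z) = deadWord w ++ killWord z := by
  simp only [killWord, deadWord, List.map_append, List.map_map, List.append_cancel_right_eq]
  refine List.map_congr_left fun ⟨σ, k⟩ _ => ?_
  cases k <;> rfl

theorem deadWord_append (w z : List (Γ × Level)) :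
    deadWord (w ++ z) = deadWord w ++ deadWord z := by
  simp [deadWord]

/-- Returns from stacks with topmost word `wz` depend on `w` only through its type: as long as a run
works on `z`, it does not see `w`, and the rest of the run is part of the type. -/
theorem Ret.congr {S : System Γ Q} {v w : List (Γ × Level)} (hvw : wordType S v = wordType S w)
    {f z q q'} (h : Ret S f (deadWord v ++ z) q q') : Ret S f (deadWord w ++ z) q q' := by
  obtain ⟨h1, h2, -⟩ := wordType_eq_iff.1 hvw
  have h1' : topSym (deadWord v) = topSym (deadWord w) := by
    rw [topSym_deadWord, topSym_deadWord, h1]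
  have hnil : ∀ z : List (Γ × Mark), deadWord v ++ z ≠ [] → deadWord w ++ z ≠ [] := by
    intro z
    rw [ne_eq, ne_eq, ← topSym_eq_none, ← topSym_eq_none, topSym_append_congr h1']
    exact id
  generalize hx : deadWord v ++ z = x at h
  induction h generalizing z with
  | pop2 hs h =>
    subst hx
    exact .pop2 ((topSym_append_congr h1' z).symm.trans hs) h
  | @collapse f x σ q q' h =>
    rcases List.eq_nil_or_concat' z with rfl | ⟨z, a, rfl⟩
    · rw [List.append_nil] at hx ⊢
      exact (h2 _ _ _).1 (hx ▸ .collapse h)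
    · rw [← List.append_assoc] at hx
      obtain ⟨rfl, ha⟩ := List.append_inj' hx rfl
      cases ha
      rw [← List.append_assoc]
      exact .collapse h
  | @pop f x σ m q q₁ q' h hne h' ih =>
    rcases List.eq_nil_or_concat' z with rfl | ⟨z, a, rfl⟩
    · rw [List.append_nil] at hx ⊢
      exact (h2 _ _ _).1 (hx ▸ .pop h hne h')
    · rw [← List.append_assoc] at hx
      obtain ⟨rfl, ha⟩ := List.append_inj' hx rfl
      cases ha
      rw [← List.append_assoc]
      exact .pop h (hnil z hne) (ih rfl)
  | push hs h _ ih =>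
    subst hx
    refine .push ((topSym_append_congr h1' z).symm.trans hs) h ?_
    rw [List.append_assoc]
    exact ih (List.append_assoc ..).symm
  | cloneRet hs h _ _ ih₁ ih₂ =>
    subst hx
    refine .cloneRet ((topSym_append_congr h1' z).symm.trans hs) h ?_ (ih₂ rfl)
    rw [killWord_deadWord_append]
    exact ih₁ (killWord_deadWord_append ..).symm
  | cloneExit hs h _ ih =>
    subst hx
    exact .cloneExit ((topSym_append_congr h1' z).symm.trans hs) h (ih rfl)

theorem LoopTo.congr {S : System Γ Q} {v w : List (Γ × Level)} (hvw : wordType S v = wordType S w)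
    {F z y q q'} (h : LoopTo S F (v ++ z) y q q') : LoopTo S F (w ++ z) y q q' := by
  obtain ⟨h1, h2, h3⟩ := wordType_eq_iff.1 hvw
  generalize hx : v ++ z = x at h
  induction h generalizing z with
  | refl => exact .refl
  | pop h _ ih => exact .pop h (ih hx)
  | push hs h hF _ ih =>
    subst hx
    rw [List.append_assoc] at hs
    refine .push ?_ h hF (ih rfl)
    rw [List.append_assoc]
    exact (topSym_append_congr h1 _).symm.trans hs
  | clone hs h hr _ ih =>
    subst hx
    rw [List.append_assoc] at hs hr
    refine .clone ?_ h ?_ (ih rfl)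
    · rw [List.append_assoc]
      exact (topSym_append_congr h1 _).symm.trans hs
    · rw [List.append_assoc, deadWord_append]
      rw [deadWord_append] at hr
      exact hr.congr hvw
  | low h hl hs hp hl' ih ih' =>
    rcases List.eq_nil_or_concat' z with rfl | ⟨z, a, rfl⟩
    · rw [List.append_nil] at hx ⊢
      exact (h3 _ _ _).1 (hx ▸ .low h hl hs hp hl')
    · have ih' := ih' hx
      rw [← List.append_assoc] at hx ih' ⊢
      obtain ⟨rfl, ha⟩ := List.append_inj' hx rfl
      cases ha
      exact .low h (ih rfl) ((topSym_append_congr h1 z).symm.trans hs) hp ih'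

theorem wordType_append_congr {S : System Γ Q} {v w : List (Γ × Level)}
    (hvw : wordType S v = wordType S w) (z : List (Γ × Level)) :
    wordType S (v ++ z) = wordType S (w ++ z) := by
  simp only [wordType_eq_iff, deadWord_append]
  exact ⟨topSym_append_congr (wordType_eq_iff.1 hvw).1 z,
    fun f q q' => ⟨.congr hvw, .congr hvw.symm⟩, fun F q q' => ⟨.congr hvw, .congr hvw.symm⟩⟩

/-- An invariant of words with finitely many values that is compatible with appending letters is
computed by a finite automaton. -/
theorem exists_dfa_of_congr {A X : Type*} [Finite X] (f : List A → X)
    (hf : ∀ v w a, f v = f w → f (v ++ [a]) = f (w ++ [a])) :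
    ∃ (α : Type) (_ : Finite α) (M : DFA A α) (g : α → X), ∀ w, g (M.eval w) = f w := by
  classical
  obtain ⟨n, ⟨e⟩⟩ := Finite.exists_equiv_fin X
  have : Nonempty (List A) := ⟨[]⟩
  let M : DFA A (Fin n) :=
    { step := fun x a => e (f (Function.invFun f (e.symm x) ++ [a]))
      start := e (f [])
      accept := ∅ }
  refine ⟨Fin n, inferInstance, M, e.symm, fun w => ?_⟩
  induction w using List.reverseRecOn with
  | nil => simp [M, DFA.eval]
  | append_singleton w a ih =>
    rw [DFA.eval_append_singleton]
    have : e.symm (M.step (M.eval w) a) = f (Function.invFun f (e.symm (M.eval w)) ++ [a]) := by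
      simp [M]
    rw [this, ih]
    exact hf _ _ _ (Function.invFun_eq ⟨w, rfl⟩)

/-! ### Runs to a narrower stack have derivations -/

open Classical in
/-- The mark of a letter with respect to a target of width `N`. -/
noncomputable def mark (N : ℕ) (a : Elem Γ) : Mark :=
  match a.2.1 with
  | .one => .one
  | .two => if a.2.2 = N then .live else .dead

/-- The symbols and marks of the letters of a word. -/
noncomputable def markWord (N : ℕ) (w : List (Elem Γ)) : List (Γ × Mark) :=
  w.map fun a => (a.1, mark N a)

theorem markWord_append_singleton (N : ℕ) (w : List (Elem Γ)) (a) :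
    markWord N (w ++ [a]) = markWord N w ++ [(a.1, mark N a)] := by
  simp [markWord]

theorem proj_append (w z : List (Elem Γ)) : proj (w ++ z) = proj w ++ proj z := by
  simp [proj]

theorem proj_append_singleton (w : List (Elem Γ)) (a) :
    proj (w ++ [a]) = proj w ++ [(a.1, a.2.1)] := by
  simp [proj]

theorem mark_eq_one {N : ℕ} {a : Elem Γ} : mark N a = .one ↔ a.2.1 = .one := by
  obtain ⟨σ, k, j⟩ := a
  cases k with
  | one => simp [mark]
  | two => simp only [mark, reduceCtorEq, iff_false]; split_ifs <;> simp

/-- No link in a word at position `M` leads above position `M`, so the word is dead with respect to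
wider targets. -/
theorem GoodWord.markWord_eq {M N : ℕ} {w : List (Elem Γ)} (hw : GoodWord M w) (h : M < N) :
    markWord N w = deadWord (proj w) := by
  simp only [markWord, deadWord, proj, List.map_map]
  refine List.map_congr_left fun a ha => ?_
  obtain ⟨p, hp⟩ := List.mem_iff_getElem?.1 ha
  have := (hw.2 p a hp).2
  obtain ⟨σ, k, j⟩ := a
  cases k with
  | one => rfl
  | two =>
    have : j ≠ N := by have := this rfl; simp only at this; omega
    simp [mark, Level.deadMark, this]

theorem killWord_markWord (N : ℕ) (w : List (Elem Γ)) :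
    killWord (markWord N w) = deadWord (proj w) := by
  simp only [markWord, deadWord, proj, killWord, List.map_map]
  refine List.map_congr_left fun ⟨σ, k, j⟩ _ => ?_
  cases k with
  | one => rfl
  | two =>
    by_cases h : j = N <;> simp [mark, Level.deadMark, Mark.kill, h]

theorem mark_newLink {N : ℕ} {u : TwoWord Γ} {w : List (Elem Γ)} (τ : Γ) (k : Level) {f : Bool}
    (hf : f = true ↔ u.length = N) :
    mark N (τ, k, newLink u w k) = bif f then k.liveMark else k.deadMark := by
  cases k with
  | one => cases f <;> rfl
  | two => cases f <;> simp_all [mark, newLink, Level.liveMark, Level.deadMark]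

/-- Words at the positions below `k` do not change while the stack is wider than `k`. -/
theorem take_eq_of_run {S : System Γ Q} {r : ℕ → Q × TwoWord Γ} {a c k : ℕ} (hac : a ≤ c)
    (hr : ∀ i, a ≤ i → i < c → S.Trans (r i) (r (i + 1)))
    (hk : ∀ i, a ≤ i → i < c → k < (r i).2.length) (hc : k ≤ (r c).2.length) :
    (r c).2.take k = (r a).2.take k := by
  induction c, hac using Nat.le_induction with
  | base => rfl
  | succ c hac ih =>
    have hkc := hk c hac (by omega)
    rw [take_eq_of_trans (hr c hac (by omega)) hkc hc]
    exact ih (fun i h h' => hr i h (by omega)) (fun i h h' => hk i h (by omega)) hkc.le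

theorem exists_first_le {a b k : ℕ} (g : ℕ → ℕ) (hab : a ≤ b) (hb : g b ≤ k) :
    ∃ c, a ≤ c ∧ c ≤ b ∧ g c ≤ k ∧ ∀ i, a ≤ i → i < c → k < g i := by
  classical
  have h : ∃ c, a ≤ c ∧ g c ≤ k := ⟨b, hab, hb⟩
  refine ⟨Nat.find h, (Nat.find_spec h).1, Nat.find_min' h ⟨hab, hb⟩, (Nat.find_spec h).2, ?_⟩
  intro i hi hlt
  by_contra hcon
  exact Nat.find_min h hlt ⟨hi, by omega⟩

/-- After a clone of `s`, the first stack that is as wide as `s` is `s`. -/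
theorem eq_of_clone_of_run {S : System Γ Q} {r : ℕ → Q × TwoWord Γ} {s : TwoWord Γ} {x} {a c : ℕ}
    (hac : a ≤ c) (ha : (r a).2 = s ++ [x])
    (hr : ∀ i, a ≤ i → i < c → S.Trans (r i) (r (i + 1)))
    (hk : ∀ i, a ≤ i → i < c → s.length < (r i).2.length) (hc : (r c).2.length = s.length) :
    (r c).2 = s := by
  have := take_eq_of_run hac hr hk hc.ge
  rwa [ha, List.take_left, List.take_of_length_le hc.le] at this

/-- A run from `u : x` that reaches the width `N` of a narrower stack only at its end gives
a derivation. After a clone the run is cut at the first stack that is at most as wide as `u : x`: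
either `u : x` itself, or the end of the run. -/
theorem ret_of_run {S : System Γ Q} {r : ℕ → Q × TwoWord Γ} {a b N : ℕ} {f : Bool} (hab : a ≤ b)
    (hr : ∀ i, a ≤ i → i < b → S.Trans (r i) (r (i + 1))) (hN : N < (r a).2.length)
    (hw : ∀ i, a ≤ i → i < b → (r a).2.length ≤ (r i).2.length) (hb : (r b).2.length = N)
    (hf : f = true ↔ (r a).2.length = N + 1) :
    Ret S f (markWord N (topWord (r a).2)) (r a).1 (r b).1 := by
  induction hn : b - a using Nat.strong_induction_on generalizing a b N f with
  | _ n ih =>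
  subst hn
  have hlt : a < b := lt_of_le_of_ne hab (by rintro rfl; omega)
  have ht := hr a le_rfl hlt
  have hwf := ht.1.wellFormed
  obtain ⟨u, w, e, hs⟩ := hwf.exists_eq
  -- A narrower stack can only be the end of the run.
  have hend : (r (a + 1)).2.length < (r a).2.length → a + 1 = b := by
    intro h
    by_contra hne
    have := hw (a + 1) (by omega) (by omega)
    omega
  -- A move that keeps the width is followed by a run of the same kind.
  have hcont : (r (a + 1)).2.length = (r a).2.length →
      Ret S f (markWord N (topWord (r (a + 1)).2)) (r (a + 1)).1 (r b).1 := by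
    intro h
    refine ih _ (by omega) (by omega) (fun i hi => hr i (by omega)) (by omega) ?_ hb
      (by rw [h]; exact hf) rfl
    intro i hi hi'
    rw [h]
    exact hw i (by omega) hi'
  have hmove : Move S u w e (r a).1 (r (a + 1)).1 (r (a + 1)).2 := by
    have : S.Trans ((r a).1, u ++ [w ++ [e]]) ((r (a + 1)).1, (r (a + 1)).2) := by
      rw [← hs]; exact ht
    exact (trans_iff.1 this).2
  have htop : topSym (markWord N (w ++ [e])) = some e.1 := by
    rw [markWord_append_singleton, topSym_append_singleton]
  rw [hs] at hN hwf
  have hwf' := wellFormed_append.1 hwf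
  rw [hs] at hw hf hend hcont
  rw [hs, topWord_append]
  generalize hq : (r (a + 1)).1 = q₁ at *
  generalize hs' : (r (a + 1)).2 = s' at *
  cases hmove with
  | push τ hτ k h =>
    refine .push htop h ?_
    have := hcont (by simp)
    rw [topWord_append, markWord_append_singleton, mark_newLink (f := f)] at this
    · exact this
    · simpa using hf
  | pop h hne =>
    have := hcont (by simp)
    rw [topWord_append] at this
    rw [markWord_append_singleton]
    exact .pop (by rwa [mark_eq_one]) (by simpa [markWord] using hne) this
  | pop2 h hu =>
    obtain rfl := hend (by simp)
    rw [hq]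
    rw [hs'] at hb
    obtain rfl : f = true := by simp [hf, hb]
    exact .pop2 htop h
  | collapse h h2 h0 =>
    have hj : e.2.2 ≤ u.length := (goodWord_append.1 hwf'.2).2.2 h2
    obtain rfl := hend (by simp; omega)
    rw [hq]
    rw [hs', List.length_take, List.length_append, List.length_singleton] at hb
    have hN' : e.2.2 = N := by omega
    have : mark N e = .live := by simp [mark, h2, hN']
    rw [markWord_append_singleton, this]
    exact .collapse h
  | clone h =>
    obtain ⟨c, hac, hcb, hc, hlast⟩ := exists_first_le (a := a + 1) (b := b)
      (k := (u ++ [w ++ [e]]).length) (fun i => (r i).2.length) (by omega) (by omega)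
    have hac' : a + 1 < c := by
      refine lt_of_le_of_ne hac ?_
      rintro rfl
      simp only [hs', List.length_append, List.length_singleton] at hc
      omega
    -- Either the clone is undone at time `c`, or the whole rest of the run stays above it.
    rcases hcb.lt_or_eq with hcb | rfl
    · have hceq : (r c).2.length = (u ++ [w ++ [e]]).length := le_antisymm hc (hw c (by omega) hcb)
      have hrc : (r c).2 = u ++ [w ++ [e]] :=
        eq_of_clone_of_run hac hs' (fun i h h' => hr i (by omega) (by omega)) hlast hceq
      have h₁ := ih (c - (a + 1)) (by omega) (a := a + 1) (b := c)
        (N := (u ++ [w ++ [e]]).length) (f := true) (by omega)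
        (fun i h h' => hr i (by omega) (by omega)) (by rw [hs']; simp)
        (fun i h h' => by
          have := hlast i h h'
          rw [hs']
          simp only [List.length_append, List.length_singleton] at this ⊢
          omega) hceq (by rw [hs']; simp) rfl
      have h₂ := ih (b - c) (by omega) (a := c) (b := b) (N := N) (f := f) (by omega)
        (fun i h h' => hr i (by omega) (by omega)) (by rw [hrc]; exact hN)
        (fun i h h' => by rw [hrc]; exact hw i (by omega) h') hb (by rw [hrc]; exact hf) rfl
      rw [hs', hq, topWord_append, hwf'.2.markWord_eq (by simp)] at h₁
      rw [hrc, topWord_append] at h₂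
      refine .cloneRet htop h ?_ h₂
      rwa [killWord_markWord]
    · have h₁ := ih (c - (a + 1)) (by omega) (a := a + 1) (b := c) (N := N) (f := false) (by omega)
        (fun i h h' => hr i (by omega) (by omega))
        (by rw [hs']; simp only [List.length_append, List.length_singleton] at hN ⊢; omega)
        (fun i h h' => by
          have := hlast i h h'
          rw [hs']
          simp only [List.length_append, List.length_singleton] at this ⊢
          omega) hb
        (by rw [hs']; simp only [List.length_append, List.length_singleton] at hN ⊢; simp; omega)
        rfl
      rw [hs', hq, topWord_append] at h₁
      exact .cloneExit htop h h₁

/-! ### Loops have derivations -/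

theorem topSym_proj_append (w : List (Elem Γ)) (a) : topSym (proj (w ++ [a])) = some a.1 := by
  rw [proj_append_singleton, topSym_append_singleton]

/-- A run from `u : wy` to `u : w` that stays above `u : w` gives a derivation. In particular this
covers simple high loops. -/
theorem loopTo_of_run {S : System Γ Q} {r : ℕ → Q × TwoWord Γ} {a b : ℕ} {F : Option Γ}
    {u : TwoWord Γ} {w y} (hab : a ≤ b) (hr : ∀ i, a ≤ i → i < b → S.Trans (r i) (r (i + 1)))
    (hB : ∀ i, a ≤ i → i ≤ b → Below (u ++ [w]) (r i).2)
    (hF : ∀ i, a ≤ i → i ≤ b → ∀ τ, F = some τ → (r i).2 ≠ push τ .one (u ++ [w]))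
    (ha : (r a).2 = u ++ [w ++ y]) (hb : (r b).2 = u ++ [w]) :
    LoopTo S F (proj w) (proj y) (r a).1 (r b).1 := by
  induction hn : b - a using Nat.strong_induction_on generalizing a y with
  | _ n ih =>
  subst hn
  rcases hab.eq_or_lt with rfl | hlt
  · obtain rfl : y = [] := by
      rw [ha] at hb
      simpa using (List.append_inj' hb rfl).2
    exact .refl
  have hsuf : ∀ c, a < c → c ≤ b → ∀ y', (r c).2 = u ++ [w ++ y'] →
      LoopTo S F (proj w) (proj y') (r c).1 (r b).1 := fun c hc hc' y' h =>
    ih (b - c) (by omega) hc' (fun i h h' => hr i (by omega) (by omega))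
      (fun i h h' => hB i (by omega) (by omega)) (fun i h h' => hF i (by omega) (by omega)) h rfl
  have ht := hr a le_rfl hlt
  have hwf := ht.1.wellFormed
  rw [ha] at hwf
  have hwf' := wellFormed_append.1 hwf
  obtain ⟨x, e, hx⟩ := (List.eq_nil_or_concat' (w ++ y)).resolve_left hwf'.2.1
  have hmove : Move S u x e (r a).1 (r (a + 1)).1 (r (a + 1)).2 := by
    have : S.Trans ((r a).1, u ++ [x ++ [e]]) ((r (a + 1)).1, (r (a + 1)).2) := by
      rw [← hx, ← ha]; exact ht
    exact (trans_iff.1 this).2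
  have htop : topSym (proj w ++ proj y) = some e.1 := by
    rw [← proj_append, hx, topSym_proj_append]
  have hB1 := hB (a + 1) (by omega) (by omega)
  have hl1 : u.length + 1 ≤ (r (a + 1)).2.length := by simpa using hB1.length_le
  generalize hq : (r (a + 1)).1 = q₁ at *
  generalize hs' : (r (a + 1)).2 = s' at *
  cases hmove with
  | push τ hτ k h =>
    have h' := hsuf (a + 1) (by omega) (by omega) (y ++ [(τ, k, newLink u (x ++ [e]) k)])
      (by rw [hs', ← hx, List.append_assoc])
    rw [proj_append_singleton, hq] at h'
    refine .push htop h ?_ h'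
    rintro hy rfl hFτ
    obtain rfl : y = [] := by simpa [proj] using hy
    refine hF (a + 1) (by omega) (by omega) τ hFτ ?_
    rw [hs', push_append, ← hx, List.append_nil]
  | pop h hne =>
    obtain ⟨w', y', hw', rfl, -⟩ := (below_append_singleton (by simp)).1 hB1
    obtain rfl : w = w' := by simpa using hw'
    obtain rfl : y = y' ++ [e] := by simpa using hx
    have h' := hsuf (a + 1) (by omega) (by omega) y' hs'
    rw [hq] at h'
    rw [proj_append_singleton]
    exact .pop h h'
  | pop2 h hu => omega
  | collapse h h2 h0 =>
    rw [hx] at hwf'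
    have := (goodWord_append.1 hwf'.2).2.2 h2
    rw [List.length_take] at hl1
    omega
  | clone h =>
    obtain ⟨c, hac, hcb, hc, hlast⟩ := exists_first_le (a := a + 1) (b := b)
      (k := (u ++ [x ++ [e]]).length) (fun i => (r i).2.length) (by omega) (by simp [hb])
    have hceq : (r c).2.length = (u ++ [x ++ [e]]).length := by
      refine le_antisymm hc ?_
      simpa using (hB c (by omega) hcb).length_le
    have hrc : (r c).2 = u ++ [x ++ [e]] :=
      eq_of_clone_of_run hac hs' (fun i h h' => hr i (by omega) (by omega)) hlast hceq
    have h₁ := ret_of_run (S := S) (f := true) hac (fun i h h' => hr i (by omega) (by omega))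
      (by rw [hs']; simp)
      (fun i h h' => by
        have := hlast i h h'
        rw [hs']
        simp only [List.length_append, List.length_singleton] at this ⊢
        omega) hceq (by rw [hs']; simp)
    have h₂ := hsuf c (by omega) hcb y (by rw [hrc, hx])
    rw [hs', hq, topWord_append, ← hx, hwf'.2.markWord_eq (by simp), proj_append] at h₁
    exact .clone htop h h₁ h₂

theorem IsStack.of_run {S : System Γ Q} {r : ℕ → Q × TwoWord Γ} {a b : ℕ} (h : S.IsRun r a b)
    (hs : IsStack S.bot (r a).2) : IsStack S.bot (r b).2 := by
  obtain ⟨hab, h⟩ := h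
  rcases hab.eq_or_lt with rfl | hlt
  · exact hs
  · obtain ⟨b, rfl⟩ : ∃ c, b = c + 1 := ⟨b - 1, by omega⟩
    exact (h b (by omega) (by omega)).isStack

theorem isRun_of_isLoop {S : System Γ Q} {r : ℕ → Q × TwoWord Γ} {a b : ℕ}
    (h : S.IsLoop r a b) : S.IsRun r a b ∧ (r a).2 = (r b).2 := by
  refine System.IsLoop.rec (motive_1 := fun a b _ => S.IsRun r a b ∧ (r a).2 = (r b).2)
    (motive_2 := fun a b _ => S.IsRun r a b ∧ (r a).2 = (r b).2) ?_ ?_ ?_ ?_ h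
  · intro a b run ends _ _ _ _ _ _
    exact ⟨run, ends⟩
  · intro a b h
    exact ⟨h.1, h.2.1⟩
  · intro a b _ h
    exact h
  · rintro a b c _ _ ⟨⟨h1, h2⟩, h3⟩ ⟨⟨h1', h2'⟩, h3'⟩
    refine ⟨⟨h1.trans h1', fun i hi hi' => ?_⟩, h3.trans h3'⟩
    rcases lt_or_ge i b with hib | hib
    · exact h2 i hi hib
    · exact h2' i hib hi'

/-- A loop that does not visit the stack with `F` pushed at level `1` gives a derivation. -/
theorem loopTo_of_isLoop {S : System Γ Q} {r : ℕ → Q × TwoWord Γ} {a b : ℕ}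
    (h : S.IsLoop r a b) {F : Option Γ} (hs : IsStack S.bot (r a).2)
    (hF : ∀ i, a ≤ i → i ≤ b → ∀ τ, F = some τ → (r i).2 ≠ push τ .one (r a).2) :
    LoopTo S F (proj (topWord (r a).2)) [] (r a).1 (r b).1 := by
  revert F
  refine System.IsLoop.rec
    (motive_1 := fun a b _ => IsStack S.bot (r a).2 → ∀ {F : Option Γ},
      (∀ i, a ≤ i → i ≤ b → ∀ τ, F = some τ → (r i).2 ≠ push τ .one (r a).2) →
      LoopTo S F (proj (topWord (r a).2)) [] (r a).1 (r b).1)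
    (motive_2 := fun a b _ => IsStack S.bot (r a).2 → ∀ {F : Option Γ},
      (∀ i, a ≤ i → i ≤ b → ∀ τ, F = some τ → (r i).2 ≠ push τ .one (r a).2) →
      LoopTo S F (proj (topWord (r a).2)) [] (r a).1 (r b).1) ?_ ?_ ?_ ?_ h hs
  · intro a b run ends notVisited first level width inner ih hs F hF
    have hin := isRun_of_isLoop inner
    have hab := hin.1.1
    obtain ⟨b, rfl⟩ : ∃ c, b = c + 1 := ⟨b - 1, by omega⟩
    simp only [Nat.add_sub_cancel] at *
    have hwf := hs.wellFormed
    obtain ⟨u, w, ⟨σ, k, j⟩, ha⟩ := hwf.exists_eq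
    rw [ha] at first level ends width hwf
    rw [lvl?_append, Option.some.injEq] at level
    obtain rfl : k = .one := level
    obtain rfl : j = w.length := (goodWord_append.1 (wellFormed_append.1 hwf).2).2.1 rfl
    rw [pop1_append] at first
    split_ifs at first with hw
    have ha1 : (r (a + 1)).2 = u ++ [w] := (Option.some.inj first).symm
    have hb1 : (r b).2 = u ++ [w] := hin.2 ▸ ha1
    obtain ⟨w', e, rfl⟩ := (List.eq_nil_or_concat' w).resolve_left hw
    have hpush : push σ .one (r (a + 1)).2 = (r a).2 := by rw [ha1, ha, push_append]; rfl
    -- The loop inside of the low loop does not visit `s`, which arises by a push.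
    have h₁ := ih ((run.2 a le_rfl (by omega)).isStack) (F := some σ) fun i hi hi' τ hτ => by
      cases hτ
      rw [hpush]
      exact notVisited i (by omega) (by omega)
    -- The first transition can only remove the letter `σ`, the last one can only push it.
    have hm1 : Move S u (w' ++ [e]) (σ, .one, (w' ++ [e]).length) (r a).1 (r (a + 1)).1
        (u ++ [w' ++ [e]]) := by
      refine (trans_iff.1 ?_).2
      rw [← ha, ← ha1]
      exact run.2 a le_rfl (by omega)
    have hm2 : Move S u w' e (r b).1 (r (b + 1)).1
        (u ++ [w' ++ [e] ++ [(σ, .one, (w' ++ [e]).length)]]) := by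
      refine (trans_iff.1 ?_).2
      rw [← hb1, ends]
      exact run.2 b (by omega) (by omega)
    have hpop : PopStep S (r a).1 σ True (r (a + 1)).1 := by
      generalize hs' : u ++ [w' ++ [e]] = s' at hm1
      cases hm1 with
      | push τ hτ k h => simp at hs'
      | clone h => simp at hs'
      | pop h hw => simpa using h
      | pop2 h hu => simp at hs'
      | collapse h h2 h0 => cases h2
    have hback : ∃ hσ, ((r b).1, e.1, (r (b + 1)).1, Op.push σ hσ .one) ∈ S.delta := by
      generalize hs' : u ++ [w' ++ [e] ++ [(σ, .one, (w' ++ [e]).length)]] = s' at hm2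
      cases hm2 with
      | push τ hτ k h =>
        obtain ⟨rfl, rfl, -⟩ : σ = τ ∧ Level.one = k ∧ _ := by simpa using hs'
        exact ⟨hτ, h⟩
      | clone h => simpa using congrArg List.length hs'
      | pop h hw =>
        have := congrArg List.length (List.cons.inj (List.append_inj' hs' rfl).2).1
        simp at this
      | pop2 h hu => simp at hs'
      | collapse h h2 h0 =>
        have hwf1 := (run.2 a le_rfl (by omega)).isStack.wellFormed
        rw [ha1] at hwf1
        have hj := (goodWord_append.1 (wellFormed_append.1 hwf1).2).2.2 h2
        have hl := congrArg List.length hs'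
        simp only [List.length_take, List.length_append, List.length_singleton] at hl
        omega
    obtain ⟨hσ, hback⟩ := hback
    rw [ha1, topWord_append] at h₁
    rw [ha, topWord_append, proj_append_singleton]
    exact .low hpop h₁ (topSym_proj_append _ _) hback .refl
  · intro a b h hs F hF
    obtain ⟨u, w, e, ha⟩ := hs.wellFormed.exists_eq
    have hb := h.2.1
    rw [ha] at hb
    rw [ha, topWord_append]
    refine loopTo_of_run (u := u) (y := []) h.1.1 h.1.2 (fun i hi hi' => ?_) (by rwa [ha] at hF)
      (by rw [ha, List.append_nil]) hb.symm
    have hwf : WellFormed (r i).2 :=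
      (hs.of_run (b := i) ⟨hi, fun j hj hj' => h.1.2 j hj (by omega)⟩).wellFormed
    rw [← ha]
    rcases hi.eq_or_lt with rfl | hi
    · exact hwf.below_self
    rcases hi'.eq_or_lt with rfl | hi'
    · rw [h.2.1]
      exact hwf.below_self
    · exact (h.2.2 i hi hi').1.below hwf
  · intro a b _ h
    exact h
  · intro a b c h h' ih ih' hs F hF
    have h1 := isRun_of_isLoop h
    have h2 := isRun_of_isLoop h'
    have := ih' (F := F) (hs.of_run h1.1)
    rw [← h1.2] at this
    exact (ih hs fun i hi hi' => hF i hi (hi'.trans h2.1.1)).trans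
      (this fun i hi hi' => hF i (h1.1.1.trans hi) hi')

/-! ### Derivations are realized by runs -/

/-- There is a run from `c` to `d` on which all stacks but the last one satisfy `P`. -/
def RunWhile (S : System Γ Q) (P : TwoWord Γ → Prop) : Q × TwoWord Γ → Q × TwoWord Γ → Prop :=
  Relation.ReflTransGen fun c d => P c.2 ∧ S.Trans c d

theorem RunWhile.mono {S : System Γ Q} {P P' : TwoWord Γ → Prop} (hP : ∀ t, P t → P' t) {c d}
    (h : RunWhile S P c d) : RunWhile S P' c d :=
  Relation.ReflTransGen.mono (fun _ _ h => ⟨hP _ h.1, h.2⟩) _ _ h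

theorem RunWhile.head {S : System Γ Q} {P : TwoWord Γ → Prop} {c d e} (hc : P c.2)
    (h : S.Trans c d) (h' : RunWhile S P d e) : RunWhile S P c e :=
  Relation.ReflTransGen.head ⟨hc, h⟩ h'

theorem RunWhile.trans {S : System Γ Q} {P : TwoWord Γ → Prop} {c d e} (h : RunWhile S P c d)
    (h' : RunWhile S P d e) : RunWhile S P c e :=
  Relation.ReflTransGen.trans h h'

theorem RunWhile.eq_of_not {S : System Γ Q} {P : TwoWord Γ → Prop} {s : TwoWord Γ} {q q'}
    (h : RunWhile S P (q, s) (q', s)) (hs : ¬ P s) : q = q' := by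
  rcases Relation.ReflTransGen.cases_head h with h | ⟨e, h, -⟩
  · exact congrArg Prod.fst h
  · exact absurd h.1 hs

theorem RunWhile.exists_fun {S : System Γ Q} {P : TwoWord Γ → Prop} {c d}
    (h : RunWhile S P c d) : ∃ (r : ℕ → Q × TwoWord Γ) (n : ℕ), r 0 = c ∧ r n = d ∧
      ∀ i < n, P (r i).2 ∧ S.Trans (r i) (r (i + 1)) := by
  induction h using Relation.ReflTransGen.head_induction_on with
  | refl => exact ⟨fun _ => d, 0, rfl, rfl, by simp⟩
  | @head c e h _ ih =>
    obtain ⟨r, n, h0, hn, hr⟩ := ih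
    refine ⟨fun i => i.casesOn c r, n + 1, rfl, hn, fun i hi => ?_⟩
    cases i with
    | zero =>
      subst h0
      exact h
    | succ i => exact hr i (by omega)

theorem exists_of_topSym_markWord {N : ℕ} {y : List (Elem Γ)} {σ}
    (h : topSym (markWord N y) = some σ) : ∃ w e, y = w ++ [e] ∧ e.1 = σ := by
  rcases List.eq_nil_or_concat' y with rfl | ⟨w, e, rfl⟩
  · simp [markWord, topSym] at h
  · rw [markWord_append_singleton, topSym_append_singleton] at h
    exact ⟨w, e, rfl, Option.some.inj h⟩

theorem exists_of_topSym_proj {y : List (Elem Γ)} {σ}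
    (h : topSym (proj y) = some σ) : ∃ w e, y = w ++ [e] ∧ e.1 = σ := by
  rcases List.eq_nil_or_concat' y with rfl | ⟨w, e, rfl⟩
  · simp [proj, topSym] at h
  · rw [topSym_proj_append] at h
    exact ⟨w, e, rfl, Option.some.inj h⟩

theorem exists_of_markWord_eq_append {N : ℕ} {y : List (Elem Γ)} {x σ m}
    (h : markWord N y = x ++ [(σ, m)]) :
    ∃ w e, y = w ++ [e] ∧ markWord N w = x ∧ e.1 = σ ∧ mark N e = m := by
  rcases List.eq_nil_or_concat' y with rfl | ⟨w, e, rfl⟩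
  · simp [markWord] at h
  · rw [markWord_append_singleton] at h
    obtain ⟨h1, h2⟩ := List.append_inj' h rfl
    simp only [List.cons.injEq, Prod.mk.injEq, and_true] at h2
    exact ⟨w, e, rfl, h1, h2.1, h2.2⟩

theorem exists_of_proj_eq_append {y : List (Elem Γ)} {x σ k}
    (h : proj y = x ++ [(σ, k)]) : ∃ w j, y = w ++ [(σ, k, j)] ∧ proj w = x := by
  rcases List.eq_nil_or_concat' y with rfl | ⟨w, ⟨τ, l, j⟩, rfl⟩
  · simp [proj] at h
  · rw [proj_append_singleton] at h
    obtain ⟨h1, h2⟩ := List.append_inj' h rfl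
    cases h2
    exact ⟨w, j, rfl, h1⟩

/-- A derivation of `Ret` is realized from every stack `u : y` with the right marks. The assumption
`0 < N` is needed since a link `0` cannot be followed. -/
theorem Ret.runWhile {S : System Γ Q} {f x q q'} (h : Ret S f x q q') {u : TwoWord Γ} {y}
    (hs : IsStack S.bot (u ++ [y])) {N : ℕ} (hN : 0 < N) (hNu : N ≤ u.length)
    (hf : f = true ↔ u.length = N) (hx : markWord N y = x) :
    RunWhile S (fun t => ∃ r, r ≠ [] ∧ t = u ++ r) (q, u ++ [y]) (q', u.take N) := by
  have hP : ∀ (u : TwoWord Γ) y, ∃ r, r ≠ [] ∧ u ++ [y] = u ++ r := fun u y => ⟨[y], by simp, rfl⟩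
  induction h generalizing u y N with
  | pop2 ht h =>
    subst hx
    obtain ⟨w, e, rfl, rfl⟩ := exists_of_topSym_markWord ht
    have hu : u ≠ [] := by rintro rfl; simp at hNu; omega
    rw [List.take_of_length_le (hf.1 rfl).le]
    exact .single ⟨hP .., trans_iff.2 ⟨hs, .pop2 h hu⟩⟩
  | @collapse f x σ q q' h =>
    obtain ⟨w, ⟨τ, k, j⟩, rfl, rfl, rfl, hm⟩ := exists_of_markWord_eq_append hx
    obtain ⟨rfl, rfl⟩ : k = .two ∧ j = N := by
      cases k with
      | one => simp [mark] at hm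
      | two =>
        simp only [mark] at hm
        split_ifs at hm with hj
        exact ⟨rfl, hj⟩
    have := Move.collapse (S := S) (u := u) (w := w) (a := (τ, .two, j)) (q := q) (q' := q') h rfl hN
    rw [List.take_append_of_le_length hNu] at this
    exact .single ⟨hP .., trans_iff.2 ⟨hs, this⟩⟩
  | @pop f x σ m q q₁ q' h hne h' ih =>
    obtain ⟨w, e, rfl, rfl, rfl, rfl⟩ := exists_of_markWord_eq_append hx
    rw [mark_eq_one] at h
    have ht := trans_iff.2 ⟨hs, .pop h (by rintro rfl; exact hne rfl)⟩
    exact RunWhile.head (hP ..) ht (ih ht.isStack hN hNu hf rfl)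
  | @push f x σ τ hτ k q q₁ q' ht h h' ih =>
    subst hx
    obtain ⟨w, e, rfl, rfl⟩ := exists_of_topSym_markWord ht
    have ht := trans_iff.2 ⟨hs, .push τ hτ k h⟩
    refine RunWhile.head (hP ..) ht (ih ht.isStack hN hNu hf ?_)
    rw [markWord_append_singleton, mark_newLink _ _ hf]
  | @cloneRet f x σ q q₁ q₂ q' ht h h₁ h₂ ih₁ ih₂ =>
    subst hx
    obtain ⟨w, e, rfl, rfl⟩ := exists_of_topSym_markWord ht
    have ht := trans_iff.2 ⟨hs, .clone h⟩
    have i₁ := ih₁ (N := (u ++ [w ++ [e]]).length) ht.isStack (by simp) le_rfl (by simp) (by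
      rw [killWord_markWord]
      exact (wellFormed_append.1 hs.wellFormed).2.markWord_eq (by simp))
    rw [List.take_length] at i₁
    refine RunWhile.head (hP ..) ht (.trans (i₁.mono ?_) (ih₂ hs hN hNu hf rfl))
    rintro _ ⟨r, -, rfl⟩
    exact ⟨[w ++ [e]] ++ r, by simp, by simp⟩
  | @cloneExit f x σ q q₁ q' ht h h' ih =>
    subst hx
    obtain ⟨w, e, rfl, rfl⟩ := exists_of_topSym_markWord ht
    have ht := trans_iff.2 ⟨hs, .clone h⟩
    have i₁ := ih ht.isStack hN (by simp; omega) (by simp; omega) rfl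
    rw [List.take_append_of_le_length hNu] at i₁
    refine RunWhile.head (hP ..) ht (i₁.mono ?_)
    rintro _ ⟨r, -, rfl⟩
    exact ⟨[w ++ [e]] ++ r, by simp, by simp⟩

/-- Whether a part of a run is a loop depends only on the values of the run in this part. -/
theorem isLoop_shift {S : System Γ Q} {r r' : ℕ → Q × TwoWord Γ} {a b k : ℕ} (h : S.IsLoop r a b)
    (hr : ∀ i, a ≤ i → i ≤ b → r' (i + k) = r i) : S.IsLoop r' (a + k) (b + k) := by
  have hrun : ∀ {a b}, (∀ i, a ≤ i → i ≤ b → r' (i + k) = r i) → S.IsRun r a b →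
      S.IsRun r' (a + k) (b + k) := by
    rintro a b hr ⟨hab, h⟩
    refine ⟨by omega, fun i hi hi' => ?_⟩
    obtain ⟨i, rfl⟩ : ∃ j, i = j + k := ⟨i - k, by omega⟩
    rw [show i + k + 1 = i + 1 + k by omega, hr i (by omega) (by omega),
      hr (i + 1) (by omega) (by omega)]
    exact h i (by omega) (by omega)
  refine System.IsLoop.rec
    (motive_1 := fun a b _ => (∀ i, a ≤ i → i ≤ b → r' (i + k) = r i) →
      S.IsSimpleLowLoop r' (a + k) (b + k))
    (motive_2 := fun a b _ => (∀ i, a ≤ i → i ≤ b → r' (i + k) = r i) →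
      S.IsLoop r' (a + k) (b + k)) ?_ ?_ ?_ ?_ h hr
  · intro a b run ends notVisited first level width inner ih hr
    have hab := (isRun_of_isLoop inner).1.1
    have h1 : r' (a + k + 1) = r (a + 1) := by
      rw [show a + k + 1 = a + 1 + k by omega, hr _ (by omega) (by omega)]
    have ih := ih fun i hi hi' => hr i (by omega) (by omega)
    rw [show a + 1 + k = a + k + 1 by omega, show b - 1 + k = b + k - 1 by omega] at ih
    have ha := hr a le_rfl (by omega)
    refine .mk (hrun hr run) ?_ ?_ ?_ ?_ ?_ ih
    · rw [ha, hr b (by omega) le_rfl, ends]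
    · intro i hi hi'
      obtain ⟨i, rfl⟩ : ∃ j, i = j + k := ⟨i - k, by omega⟩
      rw [ha, hr i (by omega) (by omega)]
      exact notVisited i (by omega) (by omega)
    · rw [ha, h1, first]
    · rw [ha, level]
    · intro i hi hi'
      obtain ⟨i, rfl⟩ : ∃ j, i = j + k := ⟨i - k, by omega⟩
      rw [ha, hr i (by omega) (by omega)]
      exact width i (by omega) (by omega)
  · rintro a b ⟨run, ends, h⟩ hr
    have hab := run.1
    have ha := hr a le_rfl (by omega)
    refine .high ⟨hrun hr run, by rw [ha, hr b (by omega) le_rfl, ends], ?_⟩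
    intro i hi hi'
    obtain ⟨i, rfl⟩ : ∃ j, i = j + k := ⟨i - k, by omega⟩
    rw [ha, hr i (by omega) (by omega)]
    exact h i (by omega) (by omega)
  · intro a b _ ih hr
    exact .low (ih hr)
  · intro a b c h h' ih ih' hr
    have hab := (isRun_of_isLoop h).1.1
    have hbc := (isRun_of_isLoop h').1.1
    exact .comp (ih fun i hi hi' => hr i hi (by omega)) (ih' fun i hi hi' => hr i (by omega) hi')

/-- There is a loop from `(q, s)` to `(q', s)` that does not become narrower than `s` and does not
visit a stack in `A`. -/
def HasLoop (S : System Γ Q) (A : TwoWord Γ → Prop) (s : TwoWord Γ) (q q' : Q) : Prop :=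
  ∃ (r : ℕ → Q × TwoWord Γ) (n : ℕ), S.IsLoop r 0 n ∧ r 0 = (q, s) ∧ r n = (q', s) ∧
    ∀ i ≤ n, s.length ≤ (r i).2.length ∧ ¬ A (r i).2

theorem HasLoop.refl {S : System Γ Q} {A : TwoWord Γ → Prop} {s : TwoWord Γ} (hA : ¬ A s) (q : Q) :
    HasLoop S A s q q :=
  ⟨fun _ => (q, s), 0, .high ⟨⟨le_rfl, by omega⟩, rfl, by omega⟩, rfl, rfl,
    fun _ _ => ⟨le_rfl, hA⟩⟩

theorem HasLoop.trans {S : System Γ Q} {A : TwoWord Γ → Prop} {s : TwoWord Γ} {q q₁ q' : Q}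
    (h : HasLoop S A s q q₁) (h' : HasLoop S A s q₁ q') : HasLoop S A s q q' := by
  obtain ⟨r, n, h1, h2, h3, h4⟩ := h
  obtain ⟨r', n', h1', h2', h3', h4'⟩ := h'
  let t : ℕ → Q × TwoWord Γ := fun i => if i ≤ n then r i else r' (i - n)
  have ht : ∀ i ≤ n, t i = r i := fun i hi => if_pos hi
  have ht' : ∀ i, t (i + n) = r' i := by
    intro i
    rcases Nat.eq_zero_or_pos i with rfl | hi
    · rw [Nat.zero_add, ht n le_rfl, h3, h2']
    · simp only [t]
      rw [if_neg (by omega), Nat.add_sub_cancel]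
  refine ⟨t, n' + n, .comp (b := n) ?_ ?_, ?_, ?_, ?_⟩
  · exact isLoop_shift (k := 0) h1 fun i _ hi => ht i hi
  · have := isLoop_shift (k := n) (r' := t) h1' fun i _ _ => ht' i
    rwa [Nat.zero_add] at this
  · rw [ht 0 (by omega), h2]
  · rw [ht', h3']
  · intro i hi
    rcases Nat.lt_or_ge n i with hn | hn
    · obtain ⟨i, rfl⟩ : ∃ j, i = j + n := ⟨i - n, by omega⟩
      rw [ht']
      exact h4' i (by omega)
    · rw [ht i hn]
      exact h4 i hn

theorem HasLoop.high {S : System Γ Q} {A : TwoWord Γ → Prop} {s s₁ : TwoWord Γ} {q q₁ q' : Q}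
    (hA : ¬ A s) (h : S.Trans (q, s) (q₁, s₁))
    (h' : RunWhile S (fun t => Below s t ∧ t ≠ s ∧ ¬ A t) (q₁, s₁) (q', s)) :
    HasLoop S A s q q' := by
  obtain ⟨r, n, h0, hn, hr⟩ := h'.exists_fun
  refine ⟨fun i => i.casesOn (q, s) r, n + 1, .high ⟨⟨by omega, fun i _ hi => ?_⟩, ?_, ?_⟩, rfl,
    hn, fun i hi => ?_⟩
  · cases i with
    | zero => change S.Trans (q, s) (r 0); rwa [h0]
    | succ i => exact (hr i (by omega)).2
  · change s = (r n).2
    rw [hn]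
  · intro i hi hi'
    obtain ⟨i, rfl⟩ : ∃ j, i = j + 1 := ⟨i - 1, by omega⟩
    obtain ⟨⟨hB, hne, -⟩, -⟩ := hr i (by omega)
    exact ⟨hB.substack, hne.symm⟩
  · cases i with
    | zero => exact ⟨le_rfl, hA⟩
    | succ i =>
      rcases (Nat.le_of_succ_le_succ hi).eq_or_lt with rfl | hi
      · change s.length ≤ (r i).2.length ∧ ¬ A (r i).2
        rw [hn]
        exact ⟨le_rfl, hA⟩
      · obtain ⟨⟨hB, -, hA'⟩, -⟩ := hr i hi
        exact ⟨hB.length_le, hA'⟩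

/-- A loop of `pop1 s` that does not visit `s` is the inside of a simple low loop of `s`. -/
theorem HasLoop.low {S : System Γ Q} {A : TwoWord Γ → Prop} {s s₁ : TwoWord Γ} {q q₁ q₂ q' : Q}
    (hA : ¬ A s) (hAB : ∀ t, A t → Below s t) (hpop : pop1 s = some s₁) (hl : lvl? s = some .one)
    (h : S.Trans (q, s) (q₁, s₁)) (h' : HasLoop S (Below s) s₁ q₁ q₂)
    (h'' : S.Trans (q₂, s₁) (q', s)) : HasLoop S A s q q' := by
  obtain ⟨r, n, hr, h0, hn, hr'⟩ := h'
  have hw : s.length = s₁.length := by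
    have := h.1.wellFormed
    obtain ⟨u, w, e, rfl⟩ := this.exists_eq
    rw [pop1_append] at hpop
    split_ifs at hpop
    cases hpop
    simp
  have hself := h.1.wellFormed.below_self
  let t : ℕ → Q × TwoWord Γ := fun i => if i = n + 2 then (q', s) else i.casesOn (q, s) r
  have ht0 : t 0 = (q, s) := rfl
  have ht : ∀ i ≤ n, t (i + 1) = r i := fun i hi => if_neg (by omega)
  have htn : t (n + 2) = (q', s) := if_pos rfl
  have hmid : ∀ i, 0 < i → i < n + 2 → s.length ≤ (t i).2.length ∧ ¬ Below s (t i).2 := by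
    intro i hi hi'
    obtain ⟨i, rfl⟩ : ∃ j, i = j + 1 := ⟨i - 1, by omega⟩
    rw [ht i (by omega), hw]
    exact hr' i (by omega)
  have hall : ∀ i ≤ n + 2, s.length ≤ (t i).2.length ∧ ¬ A (t i).2 := by
    intro i hi
    rcases Nat.eq_zero_or_pos i with rfl | h0
    · exact ⟨le_rfl, hA⟩
    rcases hi.eq_or_lt with rfl | hi
    · rw [htn]
      exact ⟨le_rfl, hA⟩
    · exact ⟨(hmid i h0 hi).1, fun hA' => (hmid i h0 hi).2 (hAB _ hA')⟩
  refine ⟨t, n + 2, .low (.mk ⟨by omega, ?_⟩ ?_ ?_ ?_ hl ?_ ?_), ht0, htn, hall⟩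
  · intro i _ hi
    rcases Nat.eq_zero_or_pos i with rfl | hi0
    · rw [ht 0 (by omega), h0]
      exact h
    obtain ⟨i, rfl⟩ : ∃ j, i = j + 1 := ⟨i - 1, by omega⟩
    rcases (show i ≤ n by omega).eq_or_lt with rfl | hi
    · rw [ht i le_rfl, htn, hn]
      exact h''
    · rw [ht i (by omega), ht (i + 1) (by omega)]
      exact (isRun_of_isLoop hr).1.2 i (by omega) hi
  · rw [htn, ht0]
  · intro i hi hi' heq
    refine (hmid i hi hi').2 ?_
    rw [heq]
    exact hself
  · rw [ht 0 (by omega), h0]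
    exact hpop
  · intro i _ hi
    exact (hall i hi).1
  · exact isLoop_shift (k := 1) hr fun i _ hi => ht i hi

/-- The stacks that contain `s` with a letter `τ` of level `1` pushed on it, if `F = some τ`. -/
def Forbidden (F : Option Γ) (s t : TwoWord Γ) : Prop :=
  ∃ τ, F = some τ ∧ Below (push τ .one s) t

/-- Words on top of the stack `u : x` do not matter for being forbidden. -/
theorem Forbidden.of_append {F : Option Γ} {u : TwoWord Γ} {w : List (Elem Γ)} {x r}
    (h : Forbidden F (u ++ [w]) (u ++ [x] ++ r)) : Forbidden F (u ++ [w]) (u ++ [x]) := by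
  obtain ⟨τ, hτ, h⟩ := h
  exact ⟨τ, hτ, h.of_append (by simp [push_append])⟩

theorem forbidden_append_singleton {F : Option Γ} {u : TwoWord Γ} {w z : List (Elem Γ)} :
    Forbidden F (u ++ [w]) (u ++ [w ++ z]) ↔
      ∃ τ, F = some τ ∧ [(τ, Level.one, w.length)] <+: z := by
  unfold Forbidden
  refine exists_congr fun τ => and_congr_right fun _ => ?_
  rw [push_append, below_append_singleton (by simp)]
  constructor
  · rintro ⟨w', y, h, h', -⟩
    obtain rfl : _ = w' := by simpa using h
    rw [List.append_assoc, List.append_cancel_left_eq] at h'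
    exact ⟨y, h'.symm⟩
  · rintro ⟨y, rfl⟩
    exact ⟨_, y, rfl, by rw [List.append_assoc]; rfl, by simp⟩

/-- Starting a run above `s` by a transition and a further piece above `s`: if the run starts in `s`,
the part up to the next visit of `s` is a simple high loop. -/
theorem exists_runWhile_hasLoop {S : System Γ Q} {A : TwoWord Γ → Prop} {s t t₁ t₂ : TwoWord Γ}
    {q q₁ q₂ q'} (hB : Below s t) (hA : ¬ A t) (h : S.Trans (q, t) (q₁, t₁))
    (h₁ : RunWhile S (fun t => Below s t ∧ t ≠ s ∧ ¬ A t) (q₁, t₁) (q₂, t₂))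
    (h₂ : ∃ q₃, RunWhile S (fun t => Below s t ∧ t ≠ s ∧ ¬ A t) (q₂, t₂) (q₃, s) ∧
      HasLoop S A s q₃ q') :
    ∃ q₃, RunWhile S (fun t => Below s t ∧ t ≠ s ∧ ¬ A t) (q, t) (q₃, s) ∧
      HasLoop S A s q₃ q' := by
  obtain ⟨q₃, h₂, h₃⟩ := h₂
  by_cases hts : t = s
  · subst hts
    exact ⟨q, .refl, (HasLoop.high hA h (.trans h₁ h₂)).trans h₃⟩
  · exact ⟨q₃, .head ⟨hB, hts, hA⟩ h (.trans h₁ h₂), h₃⟩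

/-- A derivation of `LoopTo` is realized from every stack `u : wz` with the right symbols and levels
by a run that is strictly above `u : w` up to some moment and a loop of `u : w` from there on. -/
theorem LoopTo.exists_runWhile_hasLoop {S : System Γ Q} {F v y q q'} (h : LoopTo S F v y q q')
    {u : TwoWord Γ} {w z} (hs : IsStack S.bot (u ++ [w ++ z])) (hw0 : w ≠ []) (hw : proj w = v)
    (hz : proj z = y) (hA : ¬ Forbidden F (u ++ [w]) (u ++ [w ++ z])) :
    ∃ q₁, RunWhile S (fun t => Below (u ++ [w]) t ∧ t ≠ u ++ [w] ∧ ¬ Forbidden F (u ++ [w]) t)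
        (q, u ++ [w ++ z]) (q₁, u ++ [w]) ∧
      HasLoop S (Forbidden F (u ++ [w])) (u ++ [w]) q₁ q' := by
  induction h generalizing u w z with
  | refl =>
    obtain rfl : z = [] := by simpa [proj] using hz
    rw [List.append_nil] at hA ⊢
    exact ⟨_, .refl, .refl hA _⟩
  | @pop F v y σ k q q₁ q' h h' ih =>
    obtain ⟨z, j, rfl, rfl⟩ := exists_of_proj_eq_append hz
    have hB : Below (u ++ [w]) (u ++ [w ++ (z ++ [(σ, k, j)])]) :=
      (below_append_singleton (by simp)).2 ⟨w, _, rfl, rfl, hw0⟩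
    have ht : S.Trans (q, u ++ [w ++ (z ++ [(σ, k, j)])]) (q₁, u ++ [w ++ z]) := by
      rw [← List.append_assoc] at hs ⊢
      exact trans_iff.2 ⟨hs, .pop h (by simp [hw0])⟩
    refine Cpds.exists_runWhile_hasLoop hB hA ht .refl (ih ht.isStack hw0 hw rfl fun hA' => hA ?_)
    rw [forbidden_append_singleton] at hA' ⊢
    obtain ⟨τ, hτ, hp⟩ := hA'
    exact ⟨τ, hτ, hp.trans ⟨_, rfl⟩⟩
  | @push F v y σ τ hτ k q q₁ q' htop h hF h' ih =>
    subst hw hz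
    have hB : Below (u ++ [w]) (u ++ [w ++ z]) :=
      (below_append_singleton (by simp)).2 ⟨w, _, rfl, rfl, hw0⟩
    rw [← proj_append] at htop
    obtain ⟨x, e, hx, rfl⟩ := exists_of_topSym_proj htop
    have ht : S.Trans (q, u ++ [w ++ z])
        (q₁, u ++ [w ++ (z ++ [(τ, k, newLink u (x ++ [e]) k)])]) := by
      rw [← List.append_assoc, hx]
      rw [hx] at hs
      exact trans_iff.2 ⟨hs, .push τ hτ k h⟩
    refine Cpds.exists_runWhile_hasLoop hB hA ht .refl
      (ih ht.isStack hw0 rfl (proj_append_singleton ..) fun hA' => hA ?_)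
    rw [forbidden_append_singleton] at hA' ⊢
    obtain ⟨ρ, hρ, hp⟩ := hA'
    refine ⟨ρ, hρ, ?_⟩
    cases z with
    | nil =>
      obtain ⟨rfl, rfl, -⟩ : ρ = τ ∧ Level.one = k ∧ _ := by simpa using hp
      exact absurd hρ (hF rfl rfl)
    | cons b z => simpa using hp
  | @clone F v y σ q q₁ q₂ q' htop h h₁ h₂ ih =>
    subst hw hz
    have hB : Below (u ++ [w]) (u ++ [w ++ z]) :=
      (below_append_singleton (by simp)).2 ⟨w, _, rfl, rfl, hw0⟩
    rw [← proj_append] at htop h₁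
    obtain ⟨x, e, hx, rfl⟩ := exists_of_topSym_proj htop
    have ht : S.Trans (q, u ++ [w ++ z]) (q₁, u ++ [w ++ z] ++ [w ++ z]) := by
      rw [hx] at hs ⊢
      exact trans_iff.2 ⟨hs, .clone h⟩
    have hret := h₁.runWhile (N := (u ++ [w ++ z]).length) ht.isStack (by simp) le_rfl (by simp)
      ((wellFormed_append.1 hs.wellFormed).2.markWord_eq (by simp))
    rw [List.take_length] at hret
    refine Cpds.exists_runWhile_hasLoop hB hA ht (hret.mono ?_) (ih hs hw0 rfl rfl hA)
    rintro _ ⟨r, hr, rfl⟩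
    refine ⟨⟨u, w, z, r, rfl, rfl, hw0⟩, fun heq => ?_, fun hA' => hA (Forbidden.of_append hA')⟩
    have := congrArg List.length heq
    simp [hr] at this
  | @low F v σ τ hσ q q₁ q₂ q₃ q' h h₁ htop h₂ h₃ ih₁ ih₃ =>
    obtain rfl : z = [] := by simpa [proj] using hz
    obtain ⟨w, j, rfl, rfl⟩ := exists_of_proj_eq_append hw
    obtain ⟨x, e, rfl, rfl⟩ := exists_of_topSym_proj htop
    obtain ⟨q₄, h4, h4'⟩ := ih₃ hs hw0 hw hz hA
    rw [List.append_nil] at hs hA h4 ⊢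
    obtain rfl := h4.eq_of_not (by simp)
    obtain rfl : j = (x ++ [e]).length :=
      (goodWord_append.1 (wellFormed_append.1 hs.wellFormed).2).2.1 rfl
    have ht₁ := trans_iff.2 ⟨hs, Move.pop (S := S) (q := q) (q' := q₁) (by simpa using h)
      (show x ++ [e] ≠ [] by simp)⟩
    have ht₂ := trans_iff.2 ⟨ht₁.isStack, .push σ hσ .one h₂⟩
    obtain ⟨q₄, h5, h5'⟩ := ih₁ (z := []) (by rw [List.append_nil]; exact ht₁.isStack) (by simp) rfl
      rfl (by rw [forbidden_append_singleton]; simp)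
    rw [List.append_nil] at h5
    obtain rfl := h5.eq_of_not (by simp)
    refine ⟨q, .refl, HasLoop.trans (.low hA ?_ ?_ (lvl?_append _ _ _) ht₁ ?_ ht₂) h4'⟩
    -- Stacks that are forbidden for `s` lie above `s`, which the inner loop does not visit.
    · rintro t ⟨ρ, -, u', w', z', r, h1, rfl, hw'⟩
      rw [push_append] at h1
      obtain ⟨rfl, hx⟩ := List.append_inj' h1 rfl
      obtain rfl := (List.cons.inj hx).1
      exact ⟨u, _, _, r, rfl, by rw [List.append_assoc (x ++ [e] ++ _)], hw0⟩
    · rw [pop1_append, if_pos (by simp)]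
    · obtain ⟨r, n, h6, h7, h8, h9⟩ := h5'
      refine ⟨r, n, h6, h7, h8, fun i hi => ⟨(h9 i hi).1, fun hA' => (h9 i hi).2 ⟨σ, rfl, ?_⟩⟩⟩
      rw [push_append]
      exact hA'

/-- The loops of a stack in terms of the symbols and levels of its topmost word. -/
theorem mem_loops_iff {S : System Γ Q} {s : TwoWord Γ} (hs : IsStack S.bot s) {p : Q × Q} :
    p ∈ S.loops s ↔ LoopTo S none (proj (topWord s)) [] p.1 p.2 := by
  constructor
  · rintro ⟨r, n, h, h0, hn⟩
    have := loopTo_of_isLoop h (F := none) (by rwa [h0]) (by simp)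
    rwa [h0, hn] at this
  · intro h
    obtain ⟨u, w, e, rfl⟩ := hs.wellFormed.exists_eq
    rw [topWord_append] at h
    obtain ⟨q, h1, r, n, h2, h3, h4, -⟩ := h.exists_runWhile_hasLoop (z := [])
      (by rwa [List.append_nil]) (by simp) rfl rfl (by simp [Forbidden])
    rw [List.append_nil] at h1
    obtain rfl := h1.eq_of_not (by simp)
    exact ⟨r, n, h2, h3, h4⟩

end Cpds

theorem mainTheorem5 {Γ Q : Type*} [Finite Γ] [Finite Q] (S : Cpds.System Γ Q) :
    ∃ (α : Type) (_ : Finite α) (A : DFA (Γ × Cpds.Level) α) (value : α → Set (Q × Q)),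
      ∀ (w : List (Γ × Cpds.Level)) (s : Cpds.TwoWord Γ), Cpds.IsStack S.bot s →
        w = Cpds.proj (Cpds.topWord s) → value (A.eval w) = S.loops s := by
  obtain ⟨α, hα, A, g, hg⟩ := Cpds.exists_dfa_of_congr (Cpds.wordType S)
    fun v w a h => Cpds.wordType_append_congr h [a]
  refine ⟨α, hα, A, fun x => {p | (none, p) ∈ (g x).2.2}, ?_⟩
  rintro _ s hs rfl
  ext p
  simp only [hg, Cpds.mem_loops_iff hs]
  rfl
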